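/- Work in Minkowski spacetime $\mathbb{R}^{1,3}$ with $\langle x,y\rangle=-x_0y_0+x_1y_1+x_2y_2+x_3y_3$. A \emph{convex 4-polytope} is the convex hull of finitely many points, with nonempty interior; its \emph{hyperfaces} are its 3-dimensional faces, and its \emph{2d faces} are the 2-dimensional intersections of two distinct hyperfaces. It is \emph{null-faced} if every hyperface lies in a null hyperplane $\{x:\langle n,x\rangle=c\}$, with $n\neq 0$ and $\langle n,n\rangle=0$. A null hyperface of $P$ is \emph{past} (respectively \emph{future}) if $P$ lies on the future (respectively past) side of the hyperplane of this hyperface; a 2d face is past-past, past-future or future-future according to the types of the two hyperfaces that meet in it. A \emph{tessellation} is a locally finite family of convex 4-polytopes that cover $\mathbb{R}^{1,3}$ and have pairwise disjoint interiors, such that two 2d faces of tiles whose intersection is 2-dimensional are equal. (Every face-to-face tessellation, in particular every triangulation, satisfies the last condition, but a 2d face of one tile may also run through the interior of a hyperface of another one.) A \emph{tetrahedral diamond} is the convex hull of a spacelike tetrahedron and the two points $c\pm u$, where $u$ is a future-pointing timelike vector orthogonal to the tetrahedron, $c$ lies in the relative interior of the tetrahedron, and the eight hyperplanes that join a triangle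 of the tetrahedron to $c-u$ or to $c+u$ are all null (so $c$ is the centre of the inscribed sphere and $\langle u,u\rangle=-r^2$, with $r$ its radius). (i) Let $P$ be a null-faced 4-simplex. Each of its five hyperfaces is either past or future, but not both, and either two are past and three are future, or three are past and two are future. Of its ten 2d faces, exactly six are past-future; in the first case one is past-past and three are future-future, in the second case three are past-past and one is future-future. (ii) In every tessellation by null-faced convex 4-polytopes, each 2d face $F$ of a tile is a 2d face of only finitely many tiles, and the number of tiles in which $F$ is a past-future face equals the number of tiles in which $F$ is a past-past face plus the number of tiles in which $F$ is a future-future face. (iii) There is no tessellation of Minkowski spacetime all of whose tiles are null-faced 4-simplices. (iv) There is no tessellation of Minkowski spacetime all of whose tiles are tetrahedral diamonds. -/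

import Mathlib

/-- Four-dimensional Minkowski spacetime, with coordinates `(t, x, y, z) = (x 0, x 1, x 2, x 3)`. -/
abbrev Spacetime : Type := Fin 4 → ℝ

/-- The Minkowski scalar product, of signature `(-, +, +, +)`. -/
def minkowski (x y : Spacetime) : ℝ :=
  -(x 0 * y 0) + x 1 * y 1 + x 2 * y 2 + x 3 * y 3

/-- Future-pointing null vectors. -/
def IsFutureNull (n : Spacetime) : Prop := minkowski n n = 0 ∧ 0 < n 0

/-- Future-pointing timelike vectors. -/
def IsFutureTimelike (u : Spacetime) : Prop := minkowski u u < 0 ∧ 0 < u 0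

/-- The set `s` lies in some null hyperplane `{x | ⟨n, x⟩ = c}`. The normal `n` may be taken
future-pointing, since a nonzero null vector or its opposite is. -/
def LiesInNullHyperplane (s : Set Spacetime) : Prop :=
  ∃ n c, IsFutureNull n ∧ ∀ x ∈ s, minkowski n x = c

/-- The (affine) dimension of a subset of spacetime. -/
noncomputable def affDim (s : Set Spacetime) : ℕ := Module.finrank ℝ (vectorSpan ℝ s)

/-- Convex 4-polytopes: full-dimensional convex hulls of finitely many points. -/
def IsConvexPolytope (P : Set Spacetime) : Prop :=
  (∃ s : Set Spacetime, s.Finite ∧ P = convexHull ℝ s) ∧ (interior P).Nonempty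

/-- The hyperfaces of `P`: its three-dimensional exposed faces. -/
def IsHyperface (P h : Set Spacetime) : Prop := IsExposed ℝ P h ∧ affDim h = 3

/-- All hyperfaces of `P` are null. -/
def IsNullFaced (P : Set Spacetime) : Prop := ∀ h, IsHyperface P h → LiesInNullHyperplane h

/-- `h` is a null hyperface which bounds `P` from the past: `P` lies on the future side of the null
hyperplane of `h`. For a future-pointing null `n`, the scalar product `⟨n, x⟩` decreases
along future-pointing timelike directions, so the future side is `⟨n, x⟩ ≤ c`. -/
def IsPastHyperface (P h : Set Spacetime) : Prop :=
  IsHyperface P h ∧ ∃ n c, IsFutureNull n ∧ (∀ x ∈ h, minkowski n x = c) ∧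
    ∀ x ∈ P, minkowski n x ≤ c

/-- `h` is a null hyperface which bounds `P` from the future: `P` lies on the past side of the null
hyperplane of `h`. -/
def IsFutureHyperface (P h : Set Spacetime) : Prop :=
  IsHyperface P h ∧ ∃ n c, IsFutureNull n ∧ (∀ x ∈ h, minkowski n x = c) ∧
    ∀ x ∈ P, c ≤ minkowski n x

/-- `F` is the two-dimensional intersection of the two hyperfaces `h` and `k` of `P`. -/
def IsFaceBetween (P h k F : Set Spacetime) : Prop :=
  IsHyperface P h ∧ IsHyperface P k ∧ h ≠ k ∧ F = h ∩ k ∧ affDim F = 2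

/-- The 2d faces of a 4-polytope. -/
def IsTwoFace (P F : Set Spacetime) : Prop := ∃ h k, IsFaceBetween P h k F

/-- 2d faces between two past hyperfaces. -/
def IsPastPastFace (P F : Set Spacetime) : Prop :=
  ∃ h k, IsFaceBetween P h k F ∧ IsPastHyperface P h ∧ IsPastHyperface P k

/-- 2d faces between a past and a future hyperface. -/
def IsPastFutureFace (P F : Set Spacetime) : Prop :=
  ∃ h k, IsFaceBetween P h k F ∧ IsPastHyperface P h ∧ IsFutureHyperface P k

/-- 2d faces between two future hyperfaces. -/
def IsFutureFutureFace (P F : Set Spacetime) : Prop :=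
  ∃ h k, IsFaceBetween P h k F ∧ IsFutureHyperface P h ∧ IsFutureHyperface P k

/-- Null-faced 4-simplices. -/
def IsNullFacedSimplex (P : Set Spacetime) : Prop :=
  ∃ v : Fin 5 → Spacetime, AffineIndependent ℝ v ∧ P = convexHull ℝ (Set.range v) ∧ IsNullFaced P

/-- Tetrahedral diamonds: the convex hull of a spacelike base tetrahedron with vertices `b j`, an
initial vertex `c - u` and a final vertex `c + u`, where `u` is a future-pointing timelike vector
orthogonal to the base tetrahedron, `c` is a point in the relative interior of the base
tetrahedron, and, for each of the four triangles of the base tetrahedron, the hyperplanes that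
join this triangle to the initial and to the final vertex are null. (The last condition forces `c`
to be the centre of the inscribed sphere of the base tetrahedron and `u` to have the length of its
radius.) -/
def IsTetrahedralDiamond (P : Set Spacetime) : Prop :=
  ∃ (b : Fin 4 → Spacetime) (w : Fin 4 → ℝ) (c u : Spacetime),
    AffineIndependent ℝ b ∧
    IsFutureTimelike u ∧ (∀ j k, minkowski u (b j - b k) = 0) ∧
    (∀ j, 0 < w j) ∧ ∑ j, w j = 1 ∧ c = ∑ j, w j • b j ∧
    (∀ k, LiesInNullHyperplane (insert (c - u) (b '' {k}ᶜ))) ∧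
    (∀ k, LiesInNullHyperplane (insert (c + u) (b '' {k}ᶜ))) ∧
    P = convexHull ℝ (Set.range b ∪ {c - u, c + u})

/-- Tessellations of spacetime into convex 4-polytopes. Tiles need not meet face to face: a 2d face
of one tile may run through the interior of a hyperface of another one. It is only required that
2d faces of tiles do not overlap partially. -/
structure IsTessellation (𝒯 : Set (Set Spacetime)) : Prop where
  polytope : ∀ P ∈ 𝒯, IsConvexPolytope P
  cover : ⋃₀ 𝒯 = Set.univ
  disjoint : ∀ P ∈ 𝒯, ∀ Q ∈ 𝒯, P ≠ Q → Disjoint (interior P) (interior Q)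
  locallyFinite : LocallyFinite (fun P : 𝒯 => (P : Set Spacetime))
  faces : ∀ P ∈ 𝒯, ∀ Q ∈ 𝒯, ∀ F G, IsTwoFace P F → IsTwoFace Q G → affDim (F ∩ G) = 2 → F = G

/-!
Near a generic point `p` of a 2d face `F`, every tile that contains `p` is bounded only by
hyperplanes through `F`. There are exactly two null hyperplanes through `F`, and they cut a small
ball around `p` into four quadrants. Every tile at `p` fills one quadrant, in which case `F` is one
of its 2d faces, or a half ball, and which quadrant it fills is recorded by the types of the two
hyperfaces that meet in `F`. Hence, as the ball is covered, the two past-future quadrants together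
are filled by as many tiles with 2d face `F` as the other two quadrants.

Summing this balance over all 2d faces at a vertex `v` of the tessellation, the numbers of
past-future faces at `v`, minus those of past-past and of future-future faces, add up to zero over
the tiles with vertex `v`. For a null-faced simplex this excess is nonnegative at each vertex and
positive at some vertex, for a diamond it is negative at each vertex.
-/

open Filter Module Topology

section AffineFunctions

variable {E : Type*} [NormedAddCommGroup E] [NormedSpace ℝ E] {f g : E →ᵃ[ℝ] ℝ} {s : Set E}

lemma affineMap_linear_sub (f : E →ᵃ[ℝ] ℝ) (x y : E) : f.linear (x - y) = f x - f y :=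
  f.linearMap_vsub x y

lemma affineMap_apply_add (f : E →ᵃ[ℝ] ℝ) (x u : E) : f (x + u) = f x + f.linear u := by
  rw [add_comm x, ← vadd_eq_add, f.map_vadd, vadd_eq_add, add_comm]

lemma vectorSpan_le_ker_linear (hf : ∀ x ∈ s, f x = 0) :
    vectorSpan ℝ s ≤ LinearMap.ker f.linear := by
  rw [vectorSpan, Submodule.span_le]
  rintro _ ⟨x, hx, y, hy, rfl⟩
  simp only [vsub_eq_sub, SetLike.mem_coe, LinearMap.mem_ker, affineMap_linear_sub, hf x hx,
    hf y hy, sub_self]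

lemma linear_eq_zero_of_isLocalMin {p : E} (hf : IsLocalMin f p) : f.linear = 0 := by
  have hconv : ConvexOn ℝ Set.univ f := by
    simpa using (LinearMap.id (R := ℝ) (M := ℝ)).convexOn convex_univ |>.comp_affineMap f
  have hmin := IsMinOn.of_isLocalMin_of_convex_univ hf hconv
  ext u
  have h₁ := hmin (p + u)
  have h₂ := hmin (p + -u)
  simp only [affineMap_apply_add, map_neg] at h₁ h₂
  simp only [LinearMap.zero_apply]
  linarith

lemma finrank_vectorSpan_of_interior_nonempty (hs : (interior s).Nonempty) :
    finrank ℝ (vectorSpan ℝ s) = finrank ℝ E := by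
  have hspan : affineSpan ℝ s = ⊤ :=
    top_unique (isOpen_interior.affineSpan_eq_top hs ▸ affineSpan_mono ℝ interior_subset)
  rw [← direction_affineSpan, hspan, AffineSubspace.direction_top, finrank_top]

lemma linear_eq_zero_of_interior_nonempty (hs : (interior s).Nonempty) (hf : ∀ x ∈ s, f x = 0) :
    f.linear = 0 := by
  obtain ⟨p, hp⟩ := hs
  refine linear_eq_zero_of_isLocalMin (p := p) ?_
  filter_upwards [mem_interior_iff_mem_nhds.1 hp] with x hx
  rw [hf x hx, hf p (interior_subset hp)]

lemma exists_eq_smul_of_ker_le {p : E} (hf : f.linear ≠ 0) (hfp : f p = 0) (hgp : g p = 0)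
    (h : LinearMap.ker g.linear ≤ LinearMap.ker f.linear) : ∃ κ : ℝ, κ ≠ 0 ∧ f = κ • g := by
  have hmem := mem_span_of_iInf_ker_le_ker (L := fun _ : Unit => g.linear) (by simpa using h)
  rw [Set.range_const, Submodule.mem_span_singleton] at hmem
  obtain ⟨κ, hκ⟩ := hmem
  refine ⟨κ, ?_, AffineMap.ext_linear (p := p) hκ.symm (by simp [hfp, hgp])⟩
  rintro rfl
  exact hf (by simpa using hκ.symm)

lemma exists_apply_eq_of_linearIndependent {φ ψ : E →ₗ[ℝ] ℝ} (h : LinearIndependent ℝ ![φ, ψ])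
    (r t : ℝ) : ∃ u, φ u = r ∧ ψ u = t := by
  have key : ∀ {φ ψ : E →ₗ[ℝ] ℝ}, LinearIndependent ℝ ![φ, ψ] → ∃ u, φ u = 0 ∧ ψ u = 1 := by
    intro φ ψ h
    obtain ⟨u, hφ, hψ⟩ : ∃ u, φ u = 0 ∧ ψ u ≠ 0 := by
      by_contra! hle
      have hmem := mem_span_of_iInf_ker_le_ker (L := fun _ : Unit => φ) (K := ψ) fun u hu => by
        simpa using hle u (by simpa using hu)
      rw [Set.range_const, Submodule.mem_span_singleton] at hmem
      obtain ⟨κ, hκ⟩ := hmem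
      exact ((LinearIndependent.pair_iff' (h.ne_zero 0)).1 h) κ hκ
    exact ⟨(ψ u)⁻¹ • u, by simp [hφ], by simp [hψ]⟩
  obtain ⟨u, hu₁, hu₂⟩ := key h
  obtain ⟨v, hv₁, hv₂⟩ := key (LinearIndependent.pair_symm_iff.1 h)
  exact ⟨r • v + t • u, by simp [hu₁, hv₂], by simp [hu₂, hv₁]⟩

variable [FiniteDimensional ℝ E]

lemma finrank_ker_inf_ker_of_linearIndependent {φ ψ : E →ₗ[ℝ] ℝ}
    (h : LinearIndependent ℝ ![φ, ψ]) :
    finrank ℝ ↥(LinearMap.ker φ ⊓ LinearMap.ker ψ) + 2 = finrank ℝ E := by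
  have hrange : LinearMap.range (φ.prod ψ) = ⊤ := by
    rw [LinearMap.range_eq_top]
    rintro ⟨r, t⟩
    obtain ⟨u, hr, ht⟩ := exists_apply_eq_of_linearIndependent h r t
    exact ⟨u, by simp [hr, ht]⟩
  have := (φ.prod ψ).finrank_range_add_finrank_ker
  rw [hrange, finrank_top, finrank_prod, finrank_self, LinearMap.ker_prod] at this
  omega

lemma vectorSpan_eq_ker_linear (hs : finrank ℝ (vectorSpan ℝ s) + 1 = finrank ℝ E)
    (hf : f.linear ≠ 0) (hfs : ∀ x ∈ s, f x = 0) : vectorSpan ℝ s = LinearMap.ker f.linear :=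
  Submodule.eq_of_le_of_finrank_eq (vectorSpan_le_ker_linear hfs) (by
    have := Module.Dual.finrank_ker_add_one_of_ne_zero hf
    omega)

lemma vectorSpan_eq_ker_inf_ker (hs : finrank ℝ (vectorSpan ℝ s) + 2 = finrank ℝ E)
    (hfg : LinearIndependent ℝ ![f.linear, g.linear]) (hf : ∀ x ∈ s, f x = 0)
    (hg : ∀ x ∈ s, g x = 0) :
    vectorSpan ℝ s = LinearMap.ker f.linear ⊓ LinearMap.ker g.linear :=
  Submodule.eq_of_le_of_finrank_eq
    (le_inf (vectorSpan_le_ker_linear hf) (vectorSpan_le_ker_linear hg)) (by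
    have := finrank_ker_inf_ker_of_linearIndependent hfg
    omega)

lemma exists_eq_smul_of_forall_eq_zero (hs : finrank ℝ (vectorSpan ℝ s) + 1 = finrank ℝ E)
    (hne : s.Nonempty) (hf : f.linear ≠ 0) (hg : g.linear ≠ 0) (hfs : ∀ x ∈ s, f x = 0)
    (hgs : ∀ x ∈ s, g x = 0) : ∃ κ : ℝ, κ ≠ 0 ∧ f = κ • g := by
  obtain ⟨p, hp⟩ := hne
  refine exists_eq_smul_of_ker_le hf (hfs p hp) (hgs p hp) ?_
  rw [← vectorSpan_eq_ker_linear hs hf hfs, vectorSpan_eq_ker_linear hs hg hgs]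

lemma exists_mem_forall_eq_zero_of_eq_zero (hs : Convex ℝ s) (hne : s.Nonempty)
    {A : Set (E →ᵃ[ℝ] ℝ)} (hA : A.Finite) :
    ∃ p ∈ s, ∀ a ∈ A, a p = 0 → ∀ x ∈ s, a x = 0 := by
  induction A, hA using Set.Finite.induction_on with
  | empty => exact ⟨hne.some, hne.some_mem, by simp⟩
  | @insert b A _ hA ih =>
    obtain ⟨p, hp, hpA⟩ := ih
    by_cases hb : b p = 0 → ∀ x ∈ s, b x = 0
    · exact ⟨p, hp, by rintro a (rfl | ha); exacts [hb, hpA a ha]⟩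
    push Not at hb
    obtain ⟨hbp, q, hq, hbq⟩ := hb
    have hnear : ∀ᶠ t : ℝ in 𝓝[>] 0, ∀ a ∈ A,
        a (AffineMap.lineMap p q t) = 0 → ∀ x ∈ s, a x = 0 := by
      rw [hA.eventually_all]
      intro a ha
      by_cases hap : a p = 0
      · exact Eventually.of_forall fun t _ => hpA a ha hap
      · have hcont : Continuous fun t : ℝ => a (AffineMap.lineMap p q t) :=
          a.continuous_of_finiteDimensional.comp AffineMap.lineMap_continuous
        have := (hcont.tendsto' 0 (a p) (by simp)).eventually_ne hap
        exact (this.filter_mono nhdsWithin_le_nhds).mono fun t ht e => absurd e ht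
    obtain ⟨t, htA, ht⟩ := (hnear.and (Ioo_mem_nhdsGT one_pos)).exists
    refine ⟨AffineMap.lineMap p q t, hs.lineMap_mem hp hq (Set.Ioo_subset_Icc_self ht), ?_⟩
    rintro a (rfl | ha)
    · simp [a.apply_lineMap, AffineMap.lineMap_apply_ring', hbp, ht.1.ne', hbq]
    · exact htA a ha

end AffineFunctions

section Facets

variable {E : Type*} [NormedAddCommGroup E] [NormedSpace ℝ E] {P h k s : Set E} {f g : E →ᵃ[ℝ] ℝ}

/-- The facets of a convex set `P`: its nonempty exposed faces of codimension one. -/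
structure IsFacet (P h : Set E) : Prop where
  isExposed : IsExposed ℝ P h
  nonempty : h.Nonempty
  finrank_add_one : finrank ℝ (vectorSpan ℝ h) + 1 = finrank ℝ E

/-- The set `P` lies in the closed half-space `{x | 0 ≤ ε * f x}`. The sign `ε` selects one of the
two sides of the hyperplane `{x | f x = 0}`; it is an arbitrary real number so that a factor of `f`
can be moved into it. -/
def OnSide (f : E →ᵃ[ℝ] ℝ) (ε : ℝ) (P : Set E) : Prop := ∀ x ∈ P, 0 ≤ ε * f x

lemma onSide_one : OnSide f 1 P ↔ ∀ x ∈ P, 0 ≤ f x := by simp [OnSide]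

lemma onSide_smul {κ ε : ℝ} : OnSide (κ • f) ε P ↔ OnSide f (ε * κ) P := by
  simp [OnSide, mul_assoc]

lemma onSide_mul_of_pos {κ ε : ℝ} (hκ : 0 < κ) : OnSide f (κ * ε) P ↔ OnSide f ε P := by
  simp [OnSide, mul_assoc, hκ]

lemma OnSide.linear_eq_zero_of_neg (hP : (interior P).Nonempty) {ε : ℝ} (hε : ε ≠ 0)
    (h₁ : OnSide f ε P) (h₂ : OnSide f (-ε) P) : f.linear = 0 := by
  refine linear_eq_zero_of_interior_nonempty hP fun x hx => ?_
  have h₁ := h₁ x hx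
  have h₂ := h₂ x hx
  rw [neg_mul] at h₂
  exact (mul_eq_zero.1 (show ε * f x = 0 by linarith)).resolve_left hε

lemma isExposed_setOf_eq_zero [FiniteDimensional ℝ E] (hf : OnSide f 1 P) :
    IsExposed ℝ P {x ∈ P | f x = 0} := by
  rw [onSide_one] at hf
  rintro ⟨z, hz, hfz⟩
  refine ⟨-f.linear.toContinuousLinearMap, ?_⟩
  have hle : ∀ x y, f.linear x ≤ f.linear y ↔ f x ≤ f y := fun x y => by
    rw [← sub_nonneg, ← map_sub, affineMap_linear_sub, sub_nonneg]
  ext x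
  simp only [Set.mem_ofPred_eq, neg_apply, LinearMap.coe_toContinuousLinearMap',
    neg_le_neg_iff, hle]
  refine and_congr_right fun hx => ⟨fun e y hy => e ▸ hf y hy, fun e => le_antisymm ?_ (hf x hx)⟩
  exact hfz ▸ e z hz

lemma isFacet_setOf_eq_zero [FiniteDimensional ℝ E] (hf : f.linear ≠ 0) (hfP : OnSide f 1 P)
    (hs : s ⊆ {x ∈ P | f x = 0}) (hne : s.Nonempty)
    (hdim : finrank ℝ E ≤ finrank ℝ (vectorSpan ℝ s) + 1) : IsFacet P {x ∈ P | f x = 0} := by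
  refine ⟨isExposed_setOf_eq_zero hfP, hne.mono hs, ?_⟩
  have hker := Module.Dual.finrank_ker_add_one_of_ne_zero hf
  have hle := Submodule.finrank_mono (vectorSpan_le_ker_linear (f := f)
    (s := {x ∈ P | f x = 0}) fun x hx => hx.2)
  have hmono := Submodule.finrank_mono (vectorSpan_mono ℝ hs)
  omega

lemma IsFacet.exists_affineMap (hh : IsFacet P h) (hP : (interior P).Nonempty) :
    ∃ f : E →ᵃ[ℝ] ℝ, f.linear ≠ 0 ∧ OnSide f 1 P ∧ h = {x ∈ P | f x = 0} := by
  obtain ⟨l, hl⟩ := hh.isExposed hh.nonempty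
  obtain ⟨z, hz⟩ := hh.nonempty
  have hle : ∀ x ∈ P, l x ≤ l z := by rw [hl] at hz; exact hz.2
  let f : E →ᵃ[ℝ] ℝ := AffineMap.const ℝ E (l z) - l.toLinearMap.toAffineMap
  have hf : ∀ x, f x = l z - l x := fun x => rfl
  have hhf : h = {x ∈ P | f x = 0} := by
    rw [hl]
    ext x
    simp only [Set.mem_ofPred_eq, hf]
    refine and_congr_right fun hx => ⟨fun e => ?_, fun e y hy => ?_⟩
    · linarith [hle x hx, e z (hh.isExposed.subset hz)]
    · linarith [hle y hy]
  refine ⟨f, fun h0 => ?_, onSide_one.2 fun x hx => sub_nonneg.2 (hle x hx), hhf⟩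
  have hconst : ∀ x, f x = 0 := fun x => by
    have := affineMap_linear_sub f x z
    rw [h0, LinearMap.zero_apply, hf z, sub_self, sub_zero] at this
    exact this.symm
  have hdim := hh.finrank_add_one
  have hPh : h = P := by rw [hhf]; simp [hconst]
  rw [hPh, finrank_vectorSpan_of_interior_nonempty hP] at hdim
  omega

variable [FiniteDimensional ℝ E]

lemma IsFacet.exists_eq_and_onSide (hh : IsFacet P h) (hP : (interior P).Nonempty)
    (hf : f.linear ≠ 0) (hfh : ∀ x ∈ h, f x = 0) :
    h = {x ∈ P | f x = 0} ∧ (OnSide f 1 P ∨ OnSide f (-1) P) := by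
  obtain ⟨g, hg, hgP, hgh⟩ := hh.exists_affineMap hP
  obtain ⟨κ, hκ, rfl⟩ := exists_eq_smul_of_forall_eq_zero hh.finrank_add_one hh.nonempty hf hg hfh
    fun x hx => (hgh ▸ hx : x ∈ {x ∈ P | g x = 0}).2
  refine ⟨by rw [hgh]; simp [hκ], ?_⟩
  simp only [onSide_smul]
  rcases hκ.lt_or_gt with hκ | hκ
  · right
    simpa using (onSide_mul_of_pos (ε := 1) (neg_pos.2 hκ)).2 hgP
  · left
    simpa using (onSide_mul_of_pos (ε := 1) hκ).2 hgP

lemma IsFacet.eq_setOf_eq_zero (hh : IsFacet P h) (hP : (interior P).Nonempty)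
    (hf : f.linear ≠ 0) (hfh : ∀ x ∈ h, f x = 0) : h = {x ∈ P | f x = 0} :=
  (hh.exists_eq_and_onSide hP hf hfh).1

lemma IsFacet.linearIndependent (hh : IsFacet P h) (hk : IsFacet P k) (hP : (interior P).Nonempty)
    (hne : h ≠ k) (hhk : (h ∩ k).Nonempty) (hf : f.linear ≠ 0) (hg : g.linear ≠ 0)
    (hfh : ∀ x ∈ h, f x = 0) (hgk : ∀ x ∈ k, g x = 0) :
    LinearIndependent ℝ ![f.linear, g.linear] := by
  obtain ⟨p, hph, hpk⟩ := hhk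
  refine (LinearIndependent.pair_iff' hf).2 fun κ hκ => hne ?_
  obtain ⟨c, hc, rfl⟩ := exists_eq_smul_of_ker_le hg (hgk p hpk) (hfh p hph)
    (by rw [← hκ]; exact fun u hu => by simpa using Or.inr hu)
  rw [hh.eq_setOf_eq_zero hP hf hfh, hk.eq_setOf_eq_zero hP hg hgk]
  simp [hc]

lemma IsFacet.finrank_vectorSpan_inter_add_two_le (hh : IsFacet P h) (hk : IsFacet P k)
    (hP : (interior P).Nonempty) (hne : h ≠ k) (hhk : (h ∩ k).Nonempty) :
    finrank ℝ (vectorSpan ℝ (h ∩ k)) + 2 ≤ finrank ℝ E := by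
  obtain ⟨f, hf, -, hfh⟩ := hh.exists_affineMap hP
  obtain ⟨g, hg, -, hgk⟩ := hk.exists_affineMap hP
  have hfh : ∀ x ∈ h, f x = 0 := fun x hx => (hfh ▸ hx).2
  have hgk : ∀ x ∈ k, g x = 0 := fun x hx => (hgk ▸ hx).2
  have hfg := hh.linearIndependent hk hP hne hhk hf hg hfh hgk
  rw [← finrank_ker_inf_ker_of_linearIndependent hfg]
  exact Nat.add_le_add_right (Submodule.finrank_mono (le_inf
    (vectorSpan_le_ker_linear fun x hx => hfh x hx.1)
    (vectorSpan_le_ker_linear fun x hx => hgk x hx.2))) 2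

/-- Otherwise a generic point of the facet would satisfy all the inequalities strictly and be an
interior point. -/
lemma IsFacet.exists_mem_eq_setOf_eq_zero {A : Set (E →ᵃ[ℝ] ℝ)} (hA : A.Finite)
    (hA₀ : ∀ a ∈ A, a.linear ≠ 0) (hPA : ∀ x, x ∈ P ↔ ∀ a ∈ A, 0 ≤ a x) (hconv : Convex ℝ P)
    (hP : (interior P).Nonempty) (hh : IsFacet P h) : ∃ a ∈ A, h = {x ∈ P | a x = 0} := by
  obtain ⟨p, hp, hpA⟩ :=
    exists_mem_forall_eq_zero_of_eq_zero (hh.isExposed.convex hconv) hh.nonempty hA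
  suffices hex : ∃ a ∈ A, a p = 0 by
    obtain ⟨a, ha, hap⟩ := hex
    exact ⟨a, ha, hh.eq_setOf_eq_zero hP (hA₀ a ha) (hpA a ha hap)⟩
  by_contra! hpos
  obtain ⟨f, hf, hfP, rfl⟩ := hh.exists_affineMap hP
  have hnhds : ∀ᶠ x in 𝓝 p, x ∈ P := by
    simp only [hPA]
    rw [hA.eventually_all]
    intro a ha
    have hpa : 0 < a p := lt_of_le_of_ne ((hPA p).1 hp.1 a ha) (hpos a ha).symm
    exact (a.continuous_of_finiteDimensional.continuousAt.eventually_const_lt hpa).mono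
      fun x hx => hx.le
  exact hf (linear_eq_zero_of_isLocalMin (hnhds.mono fun x hx => by
    rw [hp.2]; exact onSide_one.1 hfP x hx))

end Facets

section Polar

variable {E : Type*} [NormedAddCommGroup E] [NormedSpace ℝ E] {o : E} {s : Set E}
  {φ : StrongDual ℝ E}

/-- The (one-sided) polar of a set with respect to the point `o`. When `o` is an interior point of
the convex hull of a finite set, the extreme points of its polar correspond to the facets of the
convex hull. -/
def polarAt (o : E) (s : Set E) : Set (StrongDual ℝ E) := {φ | ∀ v ∈ s, φ (v - o) ≤ 1}

/-- The affine function `x ↦ 1 - φ (x - o)`, which is nonnegative on `s` if `φ` lies in the polar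
of `s` at `o`. -/
noncomputable def polarFunction (o : E) (φ : StrongDual ℝ E) : E →ᵃ[ℝ] ℝ :=
  AffineMap.const ℝ E (1 + φ o) - φ.toLinearMap.toAffineMap

lemma polarFunction_apply (x : E) : polarFunction o φ x = 1 - φ (x - o) := by
  rw [map_sub, ← sub_add, sub_add_eq_add_sub]; rfl

lemma polarFunction_linear : (polarFunction o φ).linear = -φ.toLinearMap := by
  simp [polarFunction]

lemma polarAt_eq_iInter (o : E) (s : Set E) :
    polarAt o s = ⋂ v ∈ s, {φ : StrongDual ℝ E | φ (v - o) ≤ 1} := by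
  ext; simp [polarAt]

lemma isLinearMap_strongDual_apply (x : E) : IsLinearMap ℝ fun φ : StrongDual ℝ E => φ x :=
  ⟨fun _ _ => rfl, fun _ _ => rfl⟩

lemma convex_polarAt (o : E) (s : Set E) : Convex ℝ (polarAt o s) := by
  rw [polarAt_eq_iInter]
  exact convex_iInter₂ fun v _ => convex_halfSpace_le (isLinearMap_strongDual_apply (v - o)) 1

lemma onSide_polarFunction (hφ : φ ∈ polarAt o s) :
    OnSide (polarFunction o φ) 1 (convexHull ℝ s) := by
  have hconv : Convex ℝ {x | 0 ≤ polarFunction o φ x} :=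
    (convex_Ici (0 : ℝ)).affine_preimage (polarFunction o φ)
  refine onSide_one.2 fun x hx => convexHull_min (fun v hv => ?_) hconv hx
  simpa [polarFunction_apply] using hφ v hv

lemma isClosed_polarAt (o : E) (s : Set E) : IsClosed (polarAt o s) := by
  rw [polarAt_eq_iInter]
  exact isClosed_biInter fun v _ => isClosed_le (by fun_prop) continuous_const

lemma isBounded_polarAt (ho : o ∈ interior (convexHull ℝ s)) :
    Bornology.IsBounded (polarAt o s) := by
  obtain ⟨r, hr, hball⟩ := Metric.mem_nhds_iff.1 (mem_interior_iff_mem_nhds.1 ho)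
  refine (NormedSpace.isBounded_polar_of_mem_nhds_zero ℝ (Metric.ball_mem_nhds (0 : E) hr)).subset
    fun φ hφ => (StrongDual.mem_polar_iff ℝ _).2 fun u hu => ?_
  have key : ∀ u ∈ Metric.ball (0 : E) r, φ u ≤ 1 := fun u hu => by
    have := onSide_one.1 (onSide_polarFunction hφ) (o + u) (hball (by simpa using hu))
    rw [polarFunction_apply, add_sub_cancel_left] at this
    linarith
  have hneg := key (-u) (by simpa using hu)
  rw [map_neg] at hneg
  exact abs_le.2 ⟨by linarith, key u hu⟩

lemma eq_zero_of_mem_extremePoints_polarAt (hs : s.Finite)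
    (hφ : φ ∈ (polarAt o s).extremePoints ℝ) {ψ : StrongDual ℝ E}
    (hψ : ∀ v ∈ s, φ (v - o) = 1 → ψ (v - o) = 0) : ψ = 0 := by
  have hmem : ∀ ψ : StrongDual ℝ E, (∀ v ∈ s, φ (v - o) = 1 → ψ (v - o) = 0) →
      ∀ᶠ t : ℝ in 𝓝 0, φ + t • ψ ∈ polarAt o s := by
    intro ψ hψ
    simp only [polarAt, Set.mem_ofPred_eq]
    rw [hs.eventually_all]
    intro v hv
    by_cases hactive : φ (v - o) = 1
    · simp [-map_sub, hactive, hψ v hv hactive]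
    · have hlt : φ (v - o) < 1 := lt_of_le_of_ne (hφ.1 v hv) hactive
      have hcont : Continuous fun t : ℝ => (φ + t • ψ) (v - o) := by fun_prop
      exact (hcont.continuousAt.eventually_lt continuousAt_const (by simpa using hlt)).mono
        fun t ht => ht.le
  have hadd := hmem ψ hψ
  have hsub := hmem (-ψ) fun v hv e => by simp [-map_sub, hψ v hv e]
  obtain ⟨t, ⟨hadd, hsub⟩, ht⟩ :=
    (((hadd.and hsub).filter_mono nhdsWithin_le_nhds).and self_mem_nhdsWithin :
      ∀ᶠ t : ℝ in 𝓝[>] 0, _).exists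
  have hφt := ((mem_extremePoints.1 hφ).2 _ hadd _ hsub
    ⟨1 / 2, 1 / 2, by norm_num, by norm_num, by norm_num, by module⟩).1
  simpa [(show 0 < t from ht).ne'] using hφt

lemma finite_extremePoints_polarAt (o : E) (hs : s.Finite) :
    ((polarAt o s).extremePoints ℝ).Finite := by
  refine Set.Finite.of_finite_image (f := fun φ => {v ∈ s | φ (v - o) = 1})
    (hs.finite_subsets.subset ?_) fun φ hφ ψ _ e => ?_
  · rintro _ ⟨φ, -, rfl⟩
    exact Set.sep_subset _ _
  · refine sub_eq_zero.1 (eq_zero_of_mem_extremePoints_polarAt hs hφ fun v hv hactive => ?_)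
    have hv : v ∈ {v ∈ s | ψ (v - o) = 1} := (Set.ext_iff.1 e v).1 ⟨hv, hactive⟩
    rw [sub_apply, hactive, hv.2, sub_self]

variable [FiniteDimensional ℝ E]

lemma isCompact_polarAt (ho : o ∈ interior (convexHull ℝ s)) : IsCompact (polarAt o s) :=
  have := FiniteDimensional.proper ℝ (StrongDual ℝ E)
  Metric.isCompact_of_isClosed_isBounded (isClosed_polarAt o s) (isBounded_polarAt ho)

lemma vectorSpan_sup_span_eq_top_of_mem_extremePoints_polarAt (hs : s.Finite)
    (hφ : φ ∈ (polarAt o s).extremePoints ℝ) {v : E} (hv : v ∈ s) (hactive : φ (v - o) = 1) :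
    vectorSpan ℝ {v ∈ s | φ (v - o) = 1} ⊔ Submodule.span ℝ {v - o} = ⊤ := by
  by_contra hne
  obtain ⟨f, hf, hker⟩ := Submodule.exists_le_ker_of_lt_top _ (lt_top_iff_ne_top.2 hne)
  have hzero : f.toContinuousLinearMap = 0 := by
    refine eq_zero_of_mem_extremePoints_polarAt hs hφ fun w hw hwactive => ?_
    rw [LinearMap.coe_toContinuousLinearMap', ← LinearMap.mem_ker]
    apply hker
    rw [← sub_add_sub_cancel w v o]
    exact Submodule.add_mem_sup (vsub_mem_vectorSpan ℝ ⟨hw, hwactive⟩ ⟨hv, hactive⟩)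
      (Submodule.mem_span_singleton_self _)
  exact hf (by simpa using hzero)

lemma isFacet_of_mem_extremePoints_polarAt [Nontrivial E] (hs : s.Finite)
    (hφ : φ ∈ (polarAt o s).extremePoints ℝ) : φ ≠ 0 ∧
    IsFacet (convexHull ℝ s) {x ∈ convexHull ℝ s | polarFunction o φ x = 0} := by
  set t := {v ∈ s | φ (v - o) = 1} with ht
  have hts : t ⊆ {x ∈ convexHull ℝ s | polarFunction o φ x = 0} := fun v hv =>
    ⟨subset_convexHull ℝ s hv.1, by simp only [polarFunction_apply, hv.2, sub_self]⟩
  obtain ⟨v, hv⟩ : t.Nonempty := by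
    by_contra! hempty
    obtain ⟨ψ, hψ⟩ := exists_ne (0 : StrongDual ℝ E)
    refine hψ (eq_zero_of_mem_extremePoints_polarAt hs hφ fun v hv hactive => ?_)
    exact absurd (show v ∈ t from ⟨hv, hactive⟩) (by simp [hempty])
  have hφ₀ : φ ≠ 0 := by
    rintro rfl
    simpa using hv.2
  have hlinear : (polarFunction o φ).linear ≠ 0 := by
    rw [polarFunction_linear, neg_ne_zero]
    exact_mod_cast hφ₀
  refine ⟨hφ₀, isFacet_setOf_eq_zero hlinear (onSide_polarFunction hφ.1) hts ⟨v, hv⟩ ?_⟩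
  have hsup := Submodule.finrank_add_le_finrank_add_finrank (vectorSpan ℝ t)
    (Submodule.span ℝ {v - o})
  rw [vectorSpan_sup_span_eq_top_of_mem_extremePoints_polarAt hs hφ hv.1 hv.2, finrank_top] at hsup
  have hone : finrank ℝ (Submodule.span ℝ {v - o}) ≤ 1 :=
    (finrank_span_le_card _).trans (by simp)
  omega

/-- A point outside the convex hull is separated from it by a functional in the polar, hence, the
polar being the closed convex hull of its extreme points, also by one of the latter. -/
lemma mem_convexHull_of_forall_extremePoints_polarAt (hs : s.Finite)
    (ho : o ∈ interior (convexHull ℝ s)) {x : E}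
    (hx : ∀ φ ∈ (polarAt o s).extremePoints ℝ, φ (x - o) ≤ 1) : x ∈ convexHull ℝ s := by
  by_contra hxs
  obtain ⟨f, c, hlt, hcx⟩ := geometric_hahn_banach_closed_point (convex_convexHull ℝ s)
    (hs.isClosed_convexHull ℝ) hxs
  have hpos : 0 < c - f o := sub_pos.2 (hlt o (interior_subset ho))
  have hmem : (c - f o)⁻¹ • f ∈ polarAt o s := fun v hv => by
    have := hlt v (subset_convexHull ℝ s hv)
    rw [smul_apply, smul_eq_mul, inv_mul_le_iff₀ hpos, map_sub]
    linarith
  rw [← closure_convexHull_extremePoints (isCompact_polarAt ho) (convex_polarAt o s)] at hmem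
  have hle : (c - f o)⁻¹ • f ∈ {φ : StrongDual ℝ E | φ (x - o) ≤ 1} :=
    closure_minimal (convexHull_min hx (convex_halfSpace_le (isLinearMap_strongDual_apply _) 1))
      (isClosed_le (f := fun φ : StrongDual ℝ E => φ (x - o)) (by fun_prop) continuous_const) hmem
  rw [Set.mem_ofPred_eq, smul_apply, smul_eq_mul, inv_mul_le_iff₀ hpos, map_sub] at hle
  linarith

theorem exists_finite_facet_presentation [Nontrivial E] (hs : s.Finite)
    (hne : (interior (convexHull ℝ s)).Nonempty) :
    ∃ A : Set (E →ᵃ[ℝ] ℝ), A.Finite ∧ (∀ a ∈ A, a.linear ≠ 0) ∧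
      (∀ x, x ∈ convexHull ℝ s ↔ ∀ a ∈ A, 0 ≤ a x) ∧
      ∀ a ∈ A, IsFacet (convexHull ℝ s) {x ∈ convexHull ℝ s | a x = 0} := by
  obtain ⟨o, ho⟩ := hne
  refine ⟨polarFunction o '' (polarAt o s).extremePoints ℝ,
    (finite_extremePoints_polarAt o hs).image _, ?_, fun x => ⟨?_, fun hx => ?_⟩, ?_⟩
  · rintro _ ⟨φ, hφ, rfl⟩
    rw [polarFunction_linear, neg_ne_zero]
    exact_mod_cast (isFacet_of_mem_extremePoints_polarAt hs hφ).1
  · rintro hx _ ⟨φ, hφ, rfl⟩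
    exact onSide_one.1 (onSide_polarFunction hφ.1) x hx
  · refine mem_convexHull_of_forall_extremePoints_polarAt hs ho fun φ hφ => ?_
    simpa [polarFunction_apply] using hx _ ⟨φ, hφ, rfl⟩
  · rintro _ ⟨φ, hφ, rfl⟩
    exact (isFacet_of_mem_extremePoints_polarAt hs hφ).2

end Polar

section Wedges

variable {E : Type*} [NormedAddCommGroup E] [NormedSpace ℝ E] {Q S : Set E} {f g : E →ᵃ[ℝ] ℝ}
  {p w x : E} {σ τ ε : ℝ}

/-- Near `p`, the set `Q` is bounded at most by the hyperplanes `f = 0` and `g = 0`. -/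
def IsLocalWedge (f g : E →ᵃ[ℝ] ℝ) (p : E) (Q : Set E) : Prop :=
  ∀ᶠ x in 𝓝 p, (∀ ε, OnSide f ε Q → 0 ≤ ε * f x) → (∀ ε, OnSide g ε Q → 0 ≤ ε * g x) → x ∈ Q

lemma IsLocalWedge.symm (hQ : IsLocalWedge f g p Q) : IsLocalWedge g f p Q :=
  hQ.mono fun _ hx hg hf => hx hf hg

lemma IsLocalWedge.eventually_mem_of_eq_zero (hQ : IsLocalWedge f g p Q) :
    ∀ᶠ x in 𝓝 p, f x = 0 → g x = 0 → x ∈ Q :=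
  hQ.mono fun x hx hf hg => hx (fun ε _ => by simp [hf]) fun ε _ => by simp [hg]

lemma not_onSide_neg_of_mem (hx : x ∈ Q) (hσ : 0 < σ * f x) : ¬ OnSide f (-σ) Q := fun h => by
  have := h x hx
  rw [neg_mul] at this
  linarith

lemma OnSide.mul_nonneg_of_not_onSide_neg (hε : OnSide f ε Q) (hσ : ¬ OnSide f (-σ) Q) :
    0 ≤ σ * ε := by
  by_contra! hneg
  refine hσ fun x hx => ?_
  have := mul_nonneg (neg_pos.2 hneg).le (hε x hx)
  rcases eq_or_ne ε 0 with rfl | hne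
  · simp at hneg
  · nlinarith [mul_self_pos.2 hne]

lemma mul_nonneg_of_mul_pos {a : ℝ} (hε : 0 ≤ σ * ε) (ha : 0 < σ * a) : 0 ≤ ε * a := by
  rcases pos_and_pos_or_neg_and_neg_of_mul_pos ha with ⟨hσ, ha⟩ | ⟨hσ, ha⟩
  · exact mul_nonneg (nonneg_of_mul_nonneg_right hε hσ) ha.le
  · exact mul_nonneg_of_nonpos_of_nonpos (nonpos_of_mul_nonneg_right hε hσ) ha.le

lemma IsLocalWedge.eventually_mem_interior (hQ : IsLocalWedge f g p Q)
    (hfc : Continuous f) (hgc : Continuous g)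
    (hf : ¬ OnSide f (-σ) Q) (hg : ¬ OnSide g (-τ) Q) :
    ∀ᶠ x in 𝓝 p, 0 < σ * f x → 0 < τ * g x → x ∈ interior Q := by
  filter_upwards [eventually_eventually_nhds.2 hQ] with x hx hfx hgx
  rw [mem_interior_iff_mem_nhds]
  have hfx : ∀ᶠ y in 𝓝 x, 0 < σ * f y :=
    (hfc.const_mul σ).continuousAt.eventually_const_lt hfx
  have hgx : ∀ᶠ y in 𝓝 x, 0 < τ * g y :=
    (hgc.const_mul τ).continuousAt.eventually_const_lt hgx
  filter_upwards [hx, hfx, hgx] with y hy hfy hgy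
  exact hy (fun ε hε => mul_nonneg_of_mul_pos (hε.mul_nonneg_of_not_onSide_neg hf) hfy)
    fun ε hε => mul_nonneg_of_mul_pos (hε.mul_nonneg_of_not_onSide_neg hg) hgy

lemma tendsto_add_smul_nhdsGT_zero (p u : E) :
    Tendsto (fun t : ℝ => p + t • u) (𝓝[>] 0) (𝓝 p) := by
  have hcont : Continuous fun t : ℝ => p + t • u := by fun_prop
  exact (hcont.tendsto' 0 p (by simp)).mono_left nhdsWithin_le_nhds

lemma affineMap_apply_add_smul (hfp : f p = 0) (t : ℝ) (u : E) :
    f (p + t • u) = t * f.linear u := by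
  rw [affineMap_apply_add, hfp, map_smul, smul_eq_mul, zero_add]

lemma frequently_mul_pos (hfg : LinearIndependent ℝ ![f.linear, g.linear]) (hfp : f p = 0)
    (hgp : g p = 0) (hσ : σ ≠ 0) (hτ : τ ≠ 0) :
    ∃ᶠ x in 𝓝 p, 0 < σ * f x ∧ 0 < τ * g x := by
  obtain ⟨u, hfu, hgu⟩ := exists_apply_eq_of_linearIndependent hfg σ τ
  refine (tendsto_add_smul_nhdsGT_zero p u).frequently (Eventually.frequently ?_)
  filter_upwards [self_mem_nhdsWithin] with t (ht : 0 < t)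
  rw [affineMap_apply_add_smul hfp, affineMap_apply_add_smul hgp, hfu, hgu, mul_left_comm,
    mul_left_comm τ]
  exact ⟨mul_pos ht (mul_self_pos.2 hσ), mul_pos ht (mul_self_pos.2 hτ)⟩

lemma mem_vectorSpan_of_eventually_add_smul_mem (hp : p ∈ S)
    (hw : ∀ᶠ t : ℝ in 𝓝[>] 0, p + t • w ∈ S) : w ∈ vectorSpan ℝ S := by
  obtain ⟨t, hmem, ht⟩ := (hw.and self_mem_nhdsWithin).exists
  have := vsub_mem_vectorSpan ℝ hmem hp
  rw [vsub_eq_sub, add_sub_cancel_left] at this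
  exact (Submodule.smul_mem_iff _ (ne_of_gt ht)).1 this

lemma IsLocalWedge.eventually_add_smul_mem (hQ : IsLocalWedge f g p Q) (hfp : f p = 0)
    (hgp : g p = 0) (hf : ∀ ε, OnSide f ε Q → 0 ≤ ε * f.linear w)
    (hg : ∀ ε, OnSide g ε Q → 0 ≤ ε * g.linear w) : ∀ᶠ t : ℝ in 𝓝[>] 0, p + t • w ∈ Q := by
  filter_upwards [(tendsto_add_smul_nhdsGT_zero p w).eventually hQ, self_mem_nhdsWithin]
    with t htQ (ht : 0 < t)
  refine htQ (fun ε hε => ?_) fun ε hε => ?_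
  · rw [affineMap_apply_add_smul hfp, mul_left_comm]
    exact mul_nonneg ht.le (hf ε hε)
  · rw [affineMap_apply_add_smul hgp, mul_left_comm]
    exact mul_nonneg ht.le (hg ε hε)

lemma ker_inf_ker_le_vectorSpan (hp : p ∈ S) (hfp : f p = 0) (hgp : g p = 0)
    (hS : ∀ᶠ x in 𝓝 p, f x = 0 → g x = 0 → x ∈ S) :
    LinearMap.ker f.linear ⊓ LinearMap.ker g.linear ≤ vectorSpan ℝ S := by
  rintro w ⟨hfw, hgw⟩
  rw [SetLike.mem_coe, LinearMap.mem_ker] at hfw hgw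
  refine mem_vectorSpan_of_eventually_add_smul_mem hp
    (((tendsto_add_smul_nhdsGT_zero p w).eventually hS).mono fun t ht => ht ?_ ?_)
  · rw [affineMap_apply_add_smul hfp, hfw, mul_zero]
  · rw [affineMap_apply_add_smul hgp, hgw, mul_zero]

lemma IsLocalWedge.ker_le_vectorSpan (hQ : IsLocalWedge f g p Q) (hpQ : p ∈ Q)
    (hfg : LinearIndependent ℝ ![f.linear, g.linear]) (hfp : f p = 0) (hgp : g p = 0)
    (hg : ∃ q ∈ Q, g q ≠ 0) : LinearMap.ker f.linear ≤ vectorSpan ℝ {x ∈ Q | f x = 0} := by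
  intro w hfw
  rw [LinearMap.mem_ker] at hfw
  have hmem : ∀ w, f.linear w = 0 → (∀ᶠ t : ℝ in 𝓝[>] 0, p + t • w ∈ Q) →
      w ∈ vectorSpan ℝ {x ∈ Q | f x = 0} := fun w hfw hw =>
    mem_vectorSpan_of_eventually_add_smul_mem ⟨hpQ, hfp⟩
      (hw.mono fun t ht => ⟨ht, by rw [affineMap_apply_add_smul hfp, hfw, mul_zero]⟩)
  obtain ⟨q, hq, hgq⟩ := hg
  obtain ⟨v, hfv, hgv⟩ := exists_apply_eq_of_linearIndependent hfg 0 (g q)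
  have hv : v ∈ vectorSpan ℝ {x ∈ Q | f x = 0} := hmem v hfv
    (hQ.eventually_add_smul_mem hfp hgp (fun ε _ => by simp [hfv]) fun ε hε => hgv ▸ hε q hq)
  set c := g.linear w / g q with hc
  have hfw' : f.linear (w - c • v) = 0 := by simp [hfw, hfv]
  have hgw' : g.linear (w - c • v) = 0 := by simp [hgv, hc, hgq]
  have hw' := hmem (w - c • v) hfw' (hQ.eventually_add_smul_mem hfp hgp
    (fun ε _ => by rw [hfw', mul_zero]) fun ε _ => by rw [hgw', mul_zero])
  simpa using Submodule.add_mem _ hw' (Submodule.smul_mem _ c hv)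

variable [FiniteDimensional ℝ E]

lemma isLocalWedge_of_active {A : Set (E →ᵃ[ℝ] ℝ)} (hA : A.Finite)
    (hQA : ∀ x, x ∈ Q ↔ ∀ a ∈ A, 0 ≤ a x) (hpQ : p ∈ Q)
    (hactive : ∀ a ∈ A, a p = 0 → ∃ κ : ℝ, a = κ • f ∨ a = κ • g) : IsLocalWedge f g p Q := by
  have key : ∀ a ∈ A, ∀ᶠ x in 𝓝 p, (∀ ε, OnSide f ε Q → 0 ≤ ε * f x) →
      (∀ ε, OnSide g ε Q → 0 ≤ ε * g x) → 0 ≤ a x := by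
    intro a ha
    rcases ((hQA p).1 hpQ a ha).lt_or_eq with hlt | heq
    · exact (a.continuous_of_finiteDimensional.continuousAt.eventually_const_lt hlt).mono
        fun x hx _ _ => hx.le
    have haQ : ∀ x ∈ Q, 0 ≤ a x := fun x hx => (hQA x).1 hx a ha
    obtain ⟨κ, rfl | rfl⟩ := hactive a ha heq.symm
    · exact Eventually.of_forall fun x hf _ => hf κ haQ
    · exact Eventually.of_forall fun x _ hg => hg κ haQ
  filter_upwards [hA.eventually_all.2 key] with x hx hf hg
  exact (hQA x).2 fun a ha => hx a ha hf hg

lemma finrank_vectorSpan_add_two_of_eventually_mem (hp : p ∈ S)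
    (hfg : LinearIndependent ℝ ![f.linear, g.linear]) (hf : ∀ x ∈ S, f x = 0)
    (hg : ∀ x ∈ S, g x = 0) (hS : ∀ᶠ x in 𝓝 p, f x = 0 → g x = 0 → x ∈ S) :
    finrank ℝ (vectorSpan ℝ S) + 2 = finrank ℝ E := by
  rw [← finrank_ker_inf_ker_of_linearIndependent hfg,
    le_antisymm (le_inf (vectorSpan_le_ker_linear hf) (vectorSpan_le_ker_linear hg))
      (ker_inf_ker_le_vectorSpan hp (hf p hp) (hg p hp) hS)]

lemma IsLocalWedge.isFacet (hQ : IsLocalWedge f g p Q) (hpQ : p ∈ Q)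
    (hint : (interior Q).Nonempty) (hfg : LinearIndependent ℝ ![f.linear, g.linear])
    (hfp : f p = 0) (hgp : g p = 0) (hε : ε ≠ 0) (hf : OnSide f ε Q) :
    IsFacet Q {x ∈ Q | f x = 0} := by
  have hg : ∃ q ∈ Q, g q ≠ 0 := by
    by_contra! hzero
    exact hfg.ne_zero 1 (linear_eq_zero_of_interior_nonempty hint hzero)
  have hspan : vectorSpan ℝ {x ∈ Q | f x = 0} = LinearMap.ker f.linear :=
    le_antisymm (vectorSpan_le_ker_linear fun x hx => hx.2)
      (hQ.ker_le_vectorSpan hpQ hfg hfp hgp hg)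
  refine ⟨?_, ⟨p, hpQ, hfp⟩, ?_⟩
  · have := isExposed_setOf_eq_zero (f := ε • f) (P := Q) (by rwa [onSide_smul, one_mul])
    simpa [hε] using this
  · rw [hspan]
    exact Module.Dual.finrank_ker_add_one_of_ne_zero (hfg.ne_zero 0)

variable {T : Finset (Set E)}

lemma existsUnique_mem_not_onSide (hT : ∀ Q ∈ T, IsLocalWedge f g p Q)
    (hcover : ∀ᶠ x in 𝓝 p, ∃ Q ∈ T, x ∈ Q)
    (hdisj : ∀ Q ∈ T, ∀ R ∈ T, Q ≠ R → Disjoint (interior Q) (interior R))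
    (hfg : LinearIndependent ℝ ![f.linear, g.linear]) (hfp : f p = 0) (hgp : g p = 0)
    (hσ : σ ≠ 0) (hτ : τ ≠ 0) : ∃! Q, Q ∈ T ∧ ¬ OnSide f (-σ) Q ∧ ¬ OnSide g (-τ) Q := by
  have hquadrant := frequently_mul_pos hfg hfp hgp hσ hτ
  obtain ⟨x, ⟨hfx, hgx⟩, Q, hQ, hxQ⟩ := (hquadrant.and_eventually hcover).exists
  refine ⟨Q, ⟨hQ, not_onSide_neg_of_mem hxQ hfx, not_onSide_neg_of_mem hxQ hgx⟩, ?_⟩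
  rintro R ⟨hR, hfR, hgR⟩
  have hint := fun {Q} (hQ : Q ∈ T) => (hT Q hQ).eventually_mem_interior (σ := σ) (τ := τ)
    f.continuous_of_finiteDimensional g.continuous_of_finiteDimensional
  obtain ⟨y, ⟨hfy, hgy⟩, hyQ, hyR⟩ := (hquadrant.and_eventually ((hint hQ
    (not_onSide_neg_of_mem hxQ hfx) (not_onSide_neg_of_mem hxQ hgx)).and
      (hint hR hfR hgR))).exists
  by_contra hne
  exact Set.disjoint_left.1 (hdisj R hR Q hQ hne) (hyR hfy hgy) (hyQ hfy hgy)

open Finset in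
lemma card_filter_quadrants {α : Type*} (T : Finset α) (L₁ R₁ L₂ R₂ : α → Prop)
    [DecidablePred L₁] [DecidablePred R₁] [DecidablePred L₂] [DecidablePred R₂]
    (h₁ : ∀ a ∈ T, ¬ (L₁ a ∧ R₁ a)) (h₂ : ∀ a ∈ T, ¬ (L₂ a ∧ R₂ a)) :
    #{a ∈ T | L₁ a ∧ L₂ a} + #{a ∈ T | R₁ a ∧ R₂ a} + #{a ∈ T | ¬ R₁ a ∧ ¬ L₂ a} +
      #{a ∈ T | ¬ L₁ a ∧ ¬ R₂ a} =
    #{a ∈ T | L₁ a ∧ R₂ a ∨ L₂ a ∧ R₁ a} + #{a ∈ T | ¬ R₁ a ∧ ¬ R₂ a} +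
      #{a ∈ T | ¬ L₁ a ∧ ¬ L₂ a} := by
  simp only [card_filter, ← sum_add_distrib]
  refine sum_congr rfl fun a ha => ?_
  have h₁ := h₁ a ha
  have h₂ := h₂ a ha
  by_cases L₁ a <;> by_cases R₁ a <;> by_cases L₂ a <;> by_cases R₂ a <;> simp_all

open Finset Classical in
/-- Each of the four quadrants cut out by `f` and `g` is covered by exactly one of the sets. -/
theorem card_filter_onSide_eq (hT : ∀ Q ∈ T, IsLocalWedge f g p Q)
    (hint : ∀ Q ∈ T, (interior Q).Nonempty) (hcover : ∀ᶠ x in 𝓝 p, ∃ Q ∈ T, x ∈ Q)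
    (hdisj : ∀ Q ∈ T, ∀ R ∈ T, Q ≠ R → Disjoint (interior Q) (interior R))
    (hfg : LinearIndependent ℝ ![f.linear, g.linear]) (hfp : f p = 0) (hgp : g p = 0) :
    #{Q ∈ T | OnSide f 1 Q ∧ OnSide g (-1) Q ∨ OnSide g 1 Q ∧ OnSide f (-1) Q} =
      #{Q ∈ T | OnSide f 1 Q ∧ OnSide g 1 Q} + #{Q ∈ T | OnSide f (-1) Q ∧ OnSide g (-1) Q} := by
  have hquadrant : ∀ σ τ : ℝ, σ ≠ 0 → τ ≠ 0 →
      #{Q ∈ T | ¬ OnSide f (-σ) Q ∧ ¬ OnSide g (-τ) Q} = 1 := fun σ τ hσ hτ => by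
    rw [card_eq_one]
    obtain ⟨Q, hQ, huniq⟩ := existsUnique_mem_not_onSide hT hcover hdisj hfg hfp hgp hσ hτ
    refine ⟨Q, ext fun R => ?_⟩
    rw [mem_filter, mem_singleton]
    exact ⟨huniq R, by rintro rfl; exact hQ⟩
  have hpp := hquadrant 1 1 one_ne_zero one_ne_zero
  have hpm := hquadrant 1 (-1) one_ne_zero (neg_ne_zero.2 one_ne_zero)
  have hmp := hquadrant (-1) 1 (neg_ne_zero.2 one_ne_zero) one_ne_zero
  have hmm := hquadrant (-1) (-1) (neg_ne_zero.2 one_ne_zero) (neg_ne_zero.2 one_ne_zero)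
  rw [neg_neg] at hpm hmp hmm
  have hcount := card_filter_quadrants T (OnSide f 1) (OnSide f (-1)) (OnSide g 1) (OnSide g (-1))
    (fun Q hQ h => hfg.ne_zero 0 (h.1.linear_eq_zero_of_neg (hint Q hQ) one_ne_zero h.2))
    (fun Q hQ h => hfg.ne_zero 1 (h.1.linear_eq_zero_of_neg (hint Q hQ) one_ne_zero h.2))
  omega

end Wedges

section NullGeometry

variable {f g k : Spacetime →ᵃ[ℝ] ℝ} {p n m u : Spacetime}

lemma minkowski_comm (x y : Spacetime) : minkowski x y = minkowski y x := by
  simp only [minkowski]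
  ring

/-- The Minkowski scalar product as a bilinear form. -/
def minkowskiForm : Spacetime →ₗ[ℝ] Spacetime →ₗ[ℝ] ℝ :=
  LinearMap.mk₂ ℝ minkowski (fun _ _ _ => by simp [minkowski]; ring)
    (fun _ _ _ => by simp [minkowski]; ring) (fun _ _ _ => by simp [minkowski]; ring)
    fun _ _ _ => by simp [minkowski]; ring

lemma minkowskiForm_apply (x y : Spacetime) : minkowskiForm x y = minkowski x y := rfl

lemma minkowski_self_nonneg (hu : u 0 = 0) : 0 ≤ minkowski u u := by
  rw [minkowski, hu]
  nlinarith [mul_self_nonneg (u 1), mul_self_nonneg (u 2), mul_self_nonneg (u 3)]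

lemma eq_zero_of_minkowski_self_nonpos (hu : u 0 = 0) (huu : minkowski u u ≤ 0) : u = 0 := by
  rw [minkowski, hu] at huu
  have h₁ := mul_self_nonneg (u 1)
  have h₂ := mul_self_nonneg (u 2)
  have h₃ := mul_self_nonneg (u 3)
  ext i
  fin_cases i
  · exact hu
  all_goals exact mul_self_eq_zero.1 (by dsimp; linarith)

/-- The combination `m 0 • n - n 0 • m` of `n` and `m` has no time component. -/
lemma minkowski_smul_sub_smul_self (n m : Spacetime) :
    minkowski (m 0 • n - n 0 • m) (m 0 • n - n 0 • m) =
      m 0 ^ 2 * minkowski n n + n 0 ^ 2 * minkowski m m - 2 * (n 0 * m 0) * minkowski n m := by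
  simp only [minkowski, Pi.sub_apply, Pi.smul_apply, smul_eq_mul]
  ring

lemma IsFutureNull.minkowski_neg_of_timelike (hn : IsFutureNull n) (hu : IsFutureTimelike u) :
    minkowski n u < 0 := by
  have hnonneg := minkowski_self_nonneg (u := u 0 • n - n 0 • u) (by simp [mul_comm])
  rw [minkowski_smul_sub_smul_self, hn.1, mul_zero, zero_add] at hnonneg
  have hneg := mul_neg_of_pos_of_neg (pow_pos hn.2 2) hu.1
  have hpos := mul_pos hn.2 hu.2
  by_contra! hle
  linarith [mul_nonneg hpos.le hle]

lemma IsFutureNull.minkowski_neg (hn : IsFutureNull n) (hm : IsFutureNull m)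
    (hnm : ∀ κ : ℝ, m ≠ κ • n) : minkowski n m < 0 := by
  by_contra! hle
  refine hnm (m 0 / n 0) ?_
  have hzero : m 0 • n - n 0 • m = 0 := by
    refine eq_zero_of_minkowski_self_nonpos (by simp [mul_comm]) ?_
    rw [minkowski_smul_sub_smul_self, hn.1, hm.1]
    linarith [mul_nonneg (mul_pos hn.2 hm.2).le hle]
  rw [div_eq_inv_mul, mul_smul, sub_eq_zero.1 hzero, inv_smul_smul₀ hn.2.ne']

/-- Affine functions that vanish on a null hyperplane and increase along future-pointing timelike
directions. A set lies on the future side of the hyperplane if the function is nonnegative there. -/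
def IsNullCoordinate (f : Spacetime →ᵃ[ℝ] ℝ) : Prop :=
  ∃ n c, IsFutureNull n ∧ ∀ x, f x = c - minkowski n x

lemma IsFutureNull.exists_isNullCoordinate (hn : IsFutureNull n) (c : ℝ) :
    ∃ f, IsNullCoordinate f ∧ ∀ x, f x = c - minkowski n x :=
  ⟨AffineMap.const ℝ Spacetime c - (minkowskiForm n).toAffineMap, ⟨n, c, hn, fun _ => rfl⟩,
    fun _ => rfl⟩

lemma liesInNullHyperplane_iff {s : Set Spacetime} :
    LiesInNullHyperplane s ↔ ∃ f, IsNullCoordinate f ∧ ∀ x ∈ s, f x = 0 := by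
  constructor
  · rintro ⟨n, c, hn, hs⟩
    obtain ⟨f, hf, hfn⟩ := hn.exists_isNullCoordinate c
    exact ⟨f, hf, fun x hx => by rw [hfn, hs x hx, sub_self]⟩
  · rintro ⟨f, ⟨n, c, hn, hf⟩, hs⟩
    exact ⟨n, c, hn, fun x hx => by linarith [hf x, hs x hx]⟩

lemma linear_eq_neg_minkowskiForm {c : ℝ} (hf : ∀ x, f x = c - minkowski n x) :
    f.linear = -minkowskiForm n := by
  refine LinearMap.ext fun u => ?_
  have := affineMap_linear_sub f u 0
  rw [sub_zero, hf, hf] at this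
  rw [this]
  simp [minkowskiForm_apply, minkowski]

lemma IsNullCoordinate.linear_pos (hf : IsNullCoordinate f) (hu : IsFutureTimelike u) :
    0 < f.linear u := by
  obtain ⟨n, c, hn, hf⟩ := hf
  rw [linear_eq_neg_minkowskiForm hf, LinearMap.neg_apply, minkowskiForm_apply, neg_pos]
  exact hn.minkowski_neg_of_timelike hu

lemma isFutureTimelike_single_zero_one : IsFutureTimelike (Pi.single 0 1) := by
  simp [IsFutureTimelike, minkowski]

lemma IsNullCoordinate.linear_ne_zero (hf : IsNullCoordinate f) : f.linear ≠ 0 := fun h => by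
  simpa [h] using hf.linear_pos isFutureTimelike_single_zero_one

lemma IsNullCoordinate.pos_of_eq_smul (hf : IsNullCoordinate f) (hg : IsNullCoordinate g) {κ : ℝ}
    (h : g = κ • f) : 0 < κ := by
  have hfu := hf.linear_pos isFutureTimelike_single_zero_one
  have hgu := hg.linear_pos isFutureTimelike_single_zero_one
  rw [h, AffineMap.smul_linear, LinearMap.smul_apply, smul_eq_mul] at hgu
  exact pos_of_mul_pos_left hgu hfu.le

lemma IsNullCoordinate.exists_linear_eq_zero_and_pos (hf : IsNullCoordinate f) :
    ∃ u, f.linear u = 0 ∧ ∀ g : Spacetime →ᵃ[ℝ] ℝ, IsNullCoordinate g →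
      LinearIndependent ℝ ![f.linear, g.linear] → 0 < g.linear u := by
  obtain ⟨n, c, hn, hf⟩ := hf
  refine ⟨n, by simp [linear_eq_neg_minkowskiForm hf, minkowskiForm_apply, hn.1], ?_⟩
  rintro g ⟨m, d, hm, hg⟩ hfg
  rw [linear_eq_neg_minkowskiForm hf, linear_eq_neg_minkowskiForm hg] at hfg
  rw [linear_eq_neg_minkowskiForm hg, LinearMap.neg_apply, minkowskiForm_apply, neg_pos,
    minkowski_comm]
  refine hn.minkowski_neg hm fun κ hκ => ?_
  exact (LinearIndependent.pair_iff' (hfg.ne_zero 0)).1 hfg κ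
    (by simp [hκ])

lemma IsNullCoordinate.exists_pos_eq_smul_of_not_linearIndependent (hf : IsNullCoordinate f)
    (hg : IsNullCoordinate g) (hfp : f p = 0) (hgp : g p = 0)
    (hfg : ¬ LinearIndependent ℝ ![f.linear, g.linear]) : ∃ κ : ℝ, 0 < κ ∧ g = κ • f := by
  rw [LinearIndependent.pair_iff' hf.linear_ne_zero] at hfg
  push Not at hfg
  obtain ⟨κ, hκ⟩ := hfg
  have heq : g = κ • f := AffineMap.ext_linear (p := p) hκ.symm (by simp [hfp, hgp])
  exact ⟨κ, hf.pos_of_eq_smul hg heq, heq⟩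

lemma IsNullCoordinate.exists_pos_eq_smul (hf : IsNullCoordinate f) (hg : IsNullCoordinate g)
    (hk : IsNullCoordinate k) (hfg : LinearIndependent ℝ ![f.linear, g.linear]) (hfp : f p = 0)
    (hgp : g p = 0) (hkp : k p = 0)
    (hker : LinearMap.ker f.linear ⊓ LinearMap.ker g.linear ≤ LinearMap.ker k.linear) :
    ∃ κ : ℝ, 0 < κ ∧ (k = κ • f ∨ k = κ • g) := by
  have hmem := mem_span_of_iInf_ker_le_ker (L := ![f.linear, g.linear]) (K := k.linear)
    fun x hx => hker (by simpa using hx)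
  simp only [Matrix.range_cons, Matrix.range_empty, Set.union_empty, Set.singleton_union,
    Submodule.mem_span_pair] at hmem
  obtain ⟨α, β, hαβ⟩ := hmem
  by_cases hfk : LinearIndependent ℝ ![f.linear, k.linear]
  · by_cases hgk : LinearIndependent ℝ ![g.linear, k.linear]
    · obtain ⟨u, hfu, hu⟩ := hf.exists_linear_eq_zero_and_pos
      obtain ⟨v, hgv, hv⟩ := hg.exists_linear_eq_zero_and_pos
      obtain ⟨w, hkw, hw⟩ := hk.exists_linear_eq_zero_and_pos
      have hk_apply : ∀ x, k.linear x = α * f.linear x + β * g.linear x := fun x => by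
        simp [← hαβ]
      have hβ : 0 < β := by
        have := hu k hk hfk
        rw [hk_apply, hfu, mul_zero, zero_add] at this
        exact pos_of_mul_pos_left this (hu g hg hfg).le
      have hα : 0 < α := by
        have := hv k hk hgk
        rw [hk_apply, hgv, mul_zero, add_zero] at this
        exact pos_of_mul_pos_left this (hv f hf (LinearIndependent.pair_symm_iff.1 hfg)).le
      rw [hk_apply] at hkw
      have := mul_pos hα (hw f hf (LinearIndependent.pair_symm_iff.1 hfk))
      have := mul_pos hβ (hw g hg (LinearIndependent.pair_symm_iff.1 hgk))
      linarith
    · obtain ⟨κ, hκ, h⟩ := hg.exists_pos_eq_smul_of_not_linearIndependent hk hgp hkp hgk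
      exact ⟨κ, hκ, Or.inr h⟩
  · obtain ⟨κ, hκ, h⟩ := hf.exists_pos_eq_smul_of_not_linearIndependent hk hfp hkp hfk
    exact ⟨κ, hκ, Or.inl h⟩

end NullGeometry

section Hyperfaces

variable {f : Spacetime →ᵃ[ℝ] ℝ} {P F h : Set Spacetime} {ε δ : ℝ}

lemma nonempty_of_affDim_pos {s : Set Spacetime} (hs : 0 < affDim s) : s.Nonempty := by
  by_contra hne
  rw [Set.not_nonempty_iff_eq_empty.1 hne, affDim, vectorSpan_empty, finrank_bot] at hs
  exact hs.false

lemma isHyperface_iff_isFacet : IsHyperface P h ↔ IsFacet P h := by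
  have hfinrank : finrank ℝ Spacetime = 4 := finrank_fin_fun ℝ
  constructor
  · rintro ⟨hexp, hdim⟩
    refine ⟨hexp, nonempty_of_affDim_pos (by omega), ?_⟩
    rw [affDim] at hdim
    rw [hdim, hfinrank]
  · rintro ⟨hexp, -, hdim⟩
    rw [hfinrank] at hdim
    exact ⟨hexp, Nat.succ_injective hdim⟩

/-- The null hyperfaces of `P` on whose hyperplane `P` has the side `ε`: the past hyperfaces for
`ε = 1`, the future hyperfaces for `ε = -1`. -/
def IsNullHyperface (ε : ℝ) (P h : Set Spacetime) : Prop :=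
  IsHyperface P h ∧ ∃ f, IsNullCoordinate f ∧ (∀ x ∈ h, f x = 0) ∧ OnSide f ε P

lemma isNullHyperface_iff : IsNullHyperface ε P h ↔ IsHyperface P h ∧ ∃ n c, IsFutureNull n ∧
    (∀ x ∈ h, minkowski n x = c) ∧ ∀ x ∈ P, 0 ≤ ε * (c - minkowski n x) := by
  refine and_congr_right fun _ => ⟨?_, ?_⟩
  · rintro ⟨f, ⟨n, c, hn, hf⟩, hfh, hfP⟩
    refine ⟨n, c, hn, fun x hx => ?_, fun x hx => hf x ▸ hfP x hx⟩
    linarith [hfh x hx, hf x]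
  · rintro ⟨n, c, hn, hnh, hnP⟩
    obtain ⟨f, hf, hfn⟩ := hn.exists_isNullCoordinate c
    exact ⟨f, hf, fun x hx => by rw [hfn, hnh x hx, sub_self], fun x hx => hfn x ▸ hnP x hx⟩

lemma isPastHyperface_iff : IsPastHyperface P h ↔ IsNullHyperface 1 P h := by
  simp [isNullHyperface_iff, IsPastHyperface]

lemma isFutureHyperface_iff : IsFutureHyperface P h ↔ IsNullHyperface (-1) P h := by
  simp [isNullHyperface_iff, IsFutureHyperface]

/-- The 2d faces of `P` between a null hyperface of sign `ε` and one of sign `δ`. -/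
def IsNullFace (ε δ : ℝ) (P F : Set Spacetime) : Prop :=
  ∃ h k, IsFaceBetween P h k F ∧ IsNullHyperface ε P h ∧ IsNullHyperface δ P k

lemma isPastPastFace_iff : IsPastPastFace P F ↔ IsNullFace 1 1 P F := by
  simp only [IsPastPastFace, IsNullFace, isPastHyperface_iff]

lemma isPastFutureFace_iff : IsPastFutureFace P F ↔ IsNullFace 1 (-1) P F := by
  simp only [IsPastFutureFace, IsNullFace, isPastHyperface_iff, isFutureHyperface_iff]

lemma isFutureFutureFace_iff : IsFutureFutureFace P F ↔ IsNullFace (-1) (-1) P F := by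
  simp only [IsFutureFutureFace, IsNullFace, isFutureHyperface_iff]

lemma IsNullFace.isTwoFace (hF : IsNullFace ε δ P F) : IsTwoFace P F :=
  let ⟨h, k, hb, _⟩ := hF
  ⟨h, k, hb⟩

lemma IsHyperface.exists_isNullCoordinate (hh : IsHyperface P h) (hnull : IsNullFaced P) :
    ∃ f, IsNullCoordinate f ∧ ∀ x ∈ h, f x = 0 :=
  liesInNullHyperplane_iff.1 (hnull h hh)

end Hyperfaces

section Tessellations

variable {𝒯 : Set (Set Spacetime)} {f g k : Spacetime →ᵃ[ℝ] ℝ} {P Q F h : Set Spacetime}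
  {p : Spacetime} {ε δ : ℝ}

lemma IsConvexPolytope.isCompact (hP : IsConvexPolytope P) : IsCompact P := by
  obtain ⟨⟨s, hs, rfl⟩, -⟩ := hP
  exact hs.isCompact_convexHull ℝ

lemma IsConvexPolytope.convex (hP : IsConvexPolytope P) : Convex ℝ P := by
  obtain ⟨⟨s, -, rfl⟩, -⟩ := hP
  exact convex_convexHull ℝ s

lemma IsConvexPolytope.exists_finite_facet_presentation (hP : IsConvexPolytope P) :
    ∃ A : Set (Spacetime →ᵃ[ℝ] ℝ), A.Finite ∧ (∀ a ∈ A, a.linear ≠ 0) ∧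
      (∀ x, x ∈ P ↔ ∀ a ∈ A, 0 ≤ a x) ∧ ∀ a ∈ A, IsFacet P {x ∈ P | a x = 0} := by
  obtain ⟨⟨s, hs, rfl⟩, hint⟩ := hP
  exact _root_.exists_finite_facet_presentation hs hint

/-- The null coordinates `f` and `g` cut out the plane of the 2d set `F`. -/
structure IsNullFrame (f g : Spacetime →ᵃ[ℝ] ℝ) (F : Set Spacetime) : Prop where
  left : IsNullCoordinate f
  right : IsNullCoordinate g
  linearIndependent : LinearIndependent ℝ ![f.linear, g.linear]
  left_eq_zero : ∀ x ∈ F, f x = 0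
  right_eq_zero : ∀ x ∈ F, g x = 0
  affDim_eq_two : affDim F = 2

lemma IsNullFrame.symm (hF : IsNullFrame f g F) : IsNullFrame g f F :=
  ⟨hF.right, hF.left, LinearIndependent.pair_symm_iff.1 hF.linearIndependent, hF.right_eq_zero,
    hF.left_eq_zero, hF.affDim_eq_two⟩

lemma IsNullFrame.nonempty (hF : IsNullFrame f g F) : F.Nonempty :=
  nonempty_of_affDim_pos (by simp [hF.affDim_eq_two])

lemma IsNullFrame.exists_pos_eq_smul (hF : IsNullFrame f g F) (hk : IsNullCoordinate k)
    (hkF : ∀ x ∈ F, k x = 0) : ∃ κ : ℝ, 0 < κ ∧ (k = κ • f ∨ k = κ • g) := by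
  obtain ⟨p, hp⟩ := hF.nonempty
  refine hF.left.exists_pos_eq_smul hF.right hk hF.linearIndependent (hF.left_eq_zero p hp)
    (hF.right_eq_zero p hp) (hkF p hp) ?_
  have hdim : finrank ℝ (vectorSpan ℝ F) + 2 = finrank ℝ Spacetime := by
    rw [finrank_fin_fun]
    exact congrArg (· + 2) hF.affDim_eq_two
  rw [← vectorSpan_eq_ker_inf_ker hdim hF.linearIndependent hF.left_eq_zero hF.right_eq_zero]
  exact vectorSpan_le_ker_linear hkF

lemma IsFaceBetween.symm {h k : Set Spacetime} (hF : IsFaceBetween P h k F) :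
    IsFaceBetween P k h F := by
  obtain ⟨hh, hk, hne, rfl, hdim⟩ := hF
  exact ⟨hk, hh, hne.symm, Set.inter_comm h k, hdim⟩

lemma IsFaceBetween.subset {h k : Set Spacetime} (hF : IsFaceBetween P h k F) : F ⊆ P := by
  obtain ⟨hh, -, -, rfl, -⟩ := hF
  exact Set.inter_subset_left.trans hh.1.subset

lemma IsTwoFace.isCompact (hP : IsConvexPolytope P) (hF : IsTwoFace P F) : IsCompact F := by
  obtain ⟨h, k, hh, hk, -, rfl, -⟩ := hF
  exact (hh.1.isCompact hP.isCompact).inter (hk.1.isCompact hP.isCompact)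

lemma IsTwoFace.convex (hP : IsConvexPolytope P) (hF : IsTwoFace P F) : Convex ℝ F := by
  obtain ⟨h, k, hh, hk, -, rfl, -⟩ := hF
  exact (hh.1.convex hP.convex).inter (hk.1.convex hP.convex)

lemma IsTwoFace.exists_isNullFrame (hP : (interior P).Nonempty) (hnull : IsNullFaced P)
    (hF : IsTwoFace P F) :
    ∃ f g, IsNullFrame f g F ∧ F = {x ∈ P | f x = 0 ∧ g x = 0} := by
  obtain ⟨h, k, hh, hk, hne, rfl, hdim⟩ := hF
  obtain ⟨f, hf, hfh⟩ := hh.exists_isNullCoordinate hnull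
  obtain ⟨g, hg, hgk⟩ := hk.exists_isNullCoordinate hnull
  rw [isHyperface_iff_isFacet] at hh hk
  have hhk : (h ∩ k).Nonempty := nonempty_of_affDim_pos (by simp [hdim])
  have hfg := hh.linearIndependent hk hP hne hhk hf.linear_ne_zero hg.linear_ne_zero hfh hgk
  refine ⟨f, g, ⟨hf, hg, hfg, fun x hx => hfh x hx.1, fun x hx => hgk x hx.2, hdim⟩, ?_⟩
  rw [hh.eq_setOf_eq_zero hP hf.linear_ne_zero hfh, hk.eq_setOf_eq_zero hP hg.linear_ne_zero hgk]
  ext x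
  simp only [Set.mem_inter_iff, Set.mem_ofPred_eq]
  tauto

lemma IsNullFrame.exists_eq_smul_of_isFacet (hF : IsNullFrame f g F) (hnull : IsNullFaced Q)
    {a : Spacetime →ᵃ[ℝ] ℝ} (ha : a.linear ≠ 0) (hfacet : IsFacet Q {x ∈ Q | a x = 0})
    (haF : ∀ x ∈ F, a x = 0) : ∃ κ : ℝ, a = κ • f ∨ a = κ • g := by
  obtain ⟨k, hk, hkQ⟩ := (isHyperface_iff_isFacet.2 hfacet).exists_isNullCoordinate hnull
  obtain ⟨κ, hκ, rfl⟩ := exists_eq_smul_of_forall_eq_zero hfacet.finrank_add_one hfacet.nonempty ha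
    hk.linear_ne_zero (fun x hx => hx.2) hkQ
  have hkF : ∀ x ∈ F, k x = 0 := fun x hx => by simpa [hκ] using haF x hx
  obtain ⟨τ, -, rfl | rfl⟩ := hF.exists_pos_eq_smul hk hkF
  · exact ⟨κ * τ, Or.inl (smul_smul κ τ f)⟩
  · exact ⟨κ * τ, Or.inr (smul_smul κ τ g)⟩

/-- A point of `F` that lies on no facet hyperplane of a tile which does not contain all of `F`. -/
lemma IsTessellation.exists_forall_isLocalWedge (h𝒯 : IsTessellation 𝒯)
    (hnull : ∀ P ∈ 𝒯, IsNullFaced P) (hF : IsNullFrame f g F) (hcomp : IsCompact F)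
    (hconv : Convex ℝ F) : ∃ p ∈ F, ∀ Q ∈ 𝒯, p ∈ Q → IsLocalWedge f g p Q := by
  have hpresentation := fun Q : 𝒯 => (h𝒯.polytope Q Q.2).exists_finite_facet_presentation
  choose A hAfin hA₀ hQA hfacet using hpresentation
  have hfin : (⋃ Q ∈ {Q : 𝒯 | ((Q : Set Spacetime) ∩ F).Nonempty}, A Q).Finite :=
    (h𝒯.locallyFinite.finite_nonempty_inter_compact hcomp).biUnion fun Q _ => hAfin Q
  obtain ⟨p, hpF, hp⟩ := exists_mem_forall_eq_zero_of_eq_zero hconv hF.nonempty hfin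
  refine ⟨p, hpF, fun Q hQ hpQ => ?_⟩
  refine isLocalWedge_of_active (hAfin ⟨Q, hQ⟩) (hQA ⟨Q, hQ⟩) hpQ fun a ha hap => ?_
  refine hF.exists_eq_smul_of_isFacet (hnull Q hQ) (hA₀ _ a ha) (hfacet _ a ha) ?_
  exact hp a (Set.mem_biUnion (x := (⟨Q, hQ⟩ : 𝒯)) ⟨p, hpQ, hpF⟩ ha) hap

lemma IsNullFrame.affDim_eq_two_of_eventually_mem {S : Set Spacetime} (hF : IsNullFrame f g F)
    (hp : p ∈ S) (hf : ∀ x ∈ S, f x = 0) (hg : ∀ x ∈ S, g x = 0)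
    (hS : ∀ᶠ x in 𝓝 p, f x = 0 → g x = 0 → x ∈ S) : affDim S = 2 := by
  have := finrank_vectorSpan_add_two_of_eventually_mem hp hF.linearIndependent hf hg hS
  rw [finrank_fin_fun] at this
  exact Nat.add_right_cancel this

lemma IsTessellation.isFaceBetween_of_onSide (h𝒯 : IsTessellation 𝒯) (hP : P ∈ 𝒯) (hQ : Q ∈ 𝒯)
    (hPF : IsTwoFace P F) (hF : IsNullFrame f g F) (hFP : F = {x ∈ P | f x = 0 ∧ g x = 0})
    (hpF : p ∈ F) (hpQ : p ∈ Q) (hwP : IsLocalWedge f g p P) (hwQ : IsLocalWedge f g p Q)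
    (hε : ε ≠ 0) (hδ : δ ≠ 0) (hf : OnSide f ε Q) (hg : OnSide g δ Q) :
    IsFaceBetween Q {x ∈ Q | f x = 0} {x ∈ Q | g x = 0} F := by
  have hint := (h𝒯.polytope Q hQ).2
  have hfp := hF.left_eq_zero p hpF
  have hgp := hF.right_eq_zero p hpF
  have hfacet_f := hwQ.isFacet hpQ hint hF.linearIndependent hfp hgp hε hf
  have hfacet_g := hwQ.symm.isFacet hpQ hint hF.symm.linearIndependent hgp hfp hδ hg
  set G := {x ∈ Q | f x = 0} ∩ {x ∈ Q | g x = 0} with hG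
  have hpG : p ∈ G := ⟨⟨hpQ, hfp⟩, hpQ, hgp⟩
  have hG₂ : affDim G = 2 :=
    hF.affDim_eq_two_of_eventually_mem hpG (fun x hx => hx.1.2) (fun x hx => hx.2.2)
      (hwQ.eventually_mem_of_eq_zero.mono fun x hx hf hg => ⟨⟨hx hf hg, hf⟩, hx hf hg, hg⟩)
  have hGQ : IsFaceBetween Q {x ∈ Q | f x = 0} {x ∈ Q | g x = 0} G := by
    rw [← isHyperface_iff_isFacet] at hfacet_f hfacet_g
    refine ⟨hfacet_f, hfacet_g, fun heq => ?_, rfl, hG₂⟩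
    rw [hG, ← heq, Set.inter_self, hfacet_f.2] at hG₂
    omega
  have hFG : affDim (F ∩ G) = 2 := by
    refine hF.affDim_eq_two_of_eventually_mem ⟨hpF, hpG⟩ (fun x hx => hx.2.1.2)
      (fun x hx => hx.2.2.2) ?_
    filter_upwards [hwQ.eventually_mem_of_eq_zero, hwP.eventually_mem_of_eq_zero]
      with x hxQ hxP hf hg
    exact ⟨hFP ▸ ⟨hxP hf hg, hf, hg⟩, ⟨hxQ hf hg, hf⟩, hxQ hf hg, hg⟩
  rwa [h𝒯.faces P hP Q hQ F G hPF ⟨_, _, hGQ⟩ hFG]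

lemma IsNullFrame.onSide_of_isNullHyperface (hF : IsNullFrame f g F) (hQ : (interior Q).Nonempty)
    (hh : IsNullHyperface ε Q h) (hFh : F ⊆ h) :
    OnSide f ε Q ∧ h = {x ∈ Q | f x = 0} ∨ OnSide g ε Q ∧ h = {x ∈ Q | g x = 0} := by
  obtain ⟨hh, k, hk, hkh, hkQ⟩ := hh
  have heq := (isHyperface_iff_isFacet.1 hh).eq_setOf_eq_zero hQ hk.linear_ne_zero hkh
  obtain ⟨κ, hκ, rfl | rfl⟩ := hF.exists_pos_eq_smul hk fun x hx => hkh x (hFh hx)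
  all_goals
    rw [onSide_smul, mul_comm, onSide_mul_of_pos hκ] at hkQ
    simp only [AffineMap.coe_smul, Pi.smul_apply, smul_eq_mul, mul_eq_zero, hκ.ne', false_or]
      at heq
  · exact Or.inl ⟨hkQ, heq⟩
  · exact Or.inr ⟨hkQ, heq⟩

lemma IsNullFrame.onSide_of_isNullFace (hF : IsNullFrame f g F) (hQ : (interior Q).Nonempty)
    (hQF : IsNullFace ε δ Q F) :
    OnSide f ε Q ∧ OnSide g δ Q ∨ OnSide g ε Q ∧ OnSide f δ Q := by
  obtain ⟨h, k, ⟨-, -, hne, heq, -⟩, hh, hk⟩ := hQF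
  have hh := hF.onSide_of_isNullHyperface hQ hh (heq ▸ Set.inter_subset_left)
  have hk := hF.onSide_of_isNullHyperface hQ hk (heq ▸ Set.inter_subset_right)
  rcases hh with ⟨hh, heqh⟩ | ⟨hh, heqh⟩ <;> rcases hk with ⟨hk, heqk⟩ | ⟨hk, heqk⟩
  exacts [absurd (heqh.trans heqk.symm) hne, Or.inl ⟨hh, hk⟩, Or.inr ⟨hh, hk⟩,
    absurd (heqh.trans heqk.symm) hne]

lemma IsNullFrame.isNullFace_of_onSide (hF : IsNullFrame f g F)
    (hQF : IsFaceBetween Q {x ∈ Q | f x = 0} {x ∈ Q | g x = 0} F) (hf : OnSide f ε Q)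
    (hg : OnSide g δ Q) : IsNullFace ε δ Q F :=
  ⟨_, _, hQF, ⟨hQF.1, f, hF.left, fun _ hx => hx.2, hf⟩,
    hQF.2.1, g, hF.right, fun _ hx => hx.2, hg⟩

lemma IsTessellation.isNullFace_iff_onSide (h𝒯 : IsTessellation 𝒯) (hP : P ∈ 𝒯) (hQ : Q ∈ 𝒯)
    (hPF : IsTwoFace P F) (hF : IsNullFrame f g F) (hFP : F = {x ∈ P | f x = 0 ∧ g x = 0})
    (hpF : p ∈ F) (hpQ : p ∈ Q) (hwP : IsLocalWedge f g p P) (hwQ : IsLocalWedge f g p Q)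
    (hε : ε ≠ 0) (hδ : δ ≠ 0) :
    IsNullFace ε δ Q F ↔ OnSide f ε Q ∧ OnSide g δ Q ∨ OnSide g ε Q ∧ OnSide f δ Q := by
  have hface : ∀ {ε δ : ℝ}, ε ≠ 0 → δ ≠ 0 → OnSide f ε Q → OnSide g δ Q →
      IsFaceBetween Q {x ∈ Q | f x = 0} {x ∈ Q | g x = 0} F := fun hε hδ =>
    h𝒯.isFaceBetween_of_onSide hP hQ hPF hF hFP hpF hpQ hwP hwQ hε hδ
  refine ⟨hF.onSide_of_isNullFace (h𝒯.polytope Q hQ).2, ?_⟩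
  rintro (⟨hf, hg⟩ | ⟨hg, hf⟩)
  · exact hF.isNullFace_of_onSide (hface hε hδ hf hg) hf hg
  · exact hF.symm.isNullFace_of_onSide (hface hδ hε hf hg).symm hg hf

lemma IsTessellation.finite_setOf_mem (h𝒯 : IsTessellation 𝒯) (p : Spacetime) :
    {Q | Q ∈ 𝒯 ∧ p ∈ Q}.Finite := by
  refine ((h𝒯.locallyFinite.point_finite p).image Subtype.val).subset ?_
  rintro Q ⟨hQ, hp⟩
  exact ⟨⟨Q, hQ⟩, hp, rfl⟩

lemma IsTessellation.eventually_exists_mem (h𝒯 : IsTessellation 𝒯) (p : Spacetime) :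
    ∀ᶠ x in 𝓝 p, ∃ Q ∈ 𝒯, p ∈ Q ∧ x ∈ Q := by
  filter_upwards [h𝒯.locallyFinite.eventually_subset
    (fun Q => (h𝒯.polytope Q Q.2).isCompact.isClosed) p] with x hx
  obtain ⟨Q, hQ, hxQ⟩ : x ∈ ⋃₀ 𝒯 := h𝒯.cover ▸ Set.mem_univ x
  exact ⟨Q, hQ, hx (a := ⟨Q, hQ⟩) hxQ, hxQ⟩

theorem IsTessellation.finite_and_ncard_isNullFace_eq (h𝒯 : IsTessellation 𝒯)
    (hnull : ∀ P ∈ 𝒯, IsNullFaced P) (hP : P ∈ 𝒯) (hPF : IsTwoFace P F) :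
    {Q | Q ∈ 𝒯 ∧ IsTwoFace Q F}.Finite ∧ {Q | Q ∈ 𝒯 ∧ IsNullFace 1 (-1) Q F}.ncard =
      {Q | Q ∈ 𝒯 ∧ IsNullFace 1 1 Q F}.ncard + {Q | Q ∈ 𝒯 ∧ IsNullFace (-1) (-1) Q F}.ncard := by
  classical
  have hPpoly := h𝒯.polytope P hP
  obtain ⟨f, g, hF, hFP⟩ := hPF.exists_isNullFrame hPpoly.2 (hnull P hP)
  obtain ⟨p, hpF, hwedge⟩ :=
    h𝒯.exists_forall_isLocalWedge hnull hF (hPF.isCompact hPpoly) (hPF.convex hPpoly)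
  have hmem : ∀ {Q}, IsTwoFace Q F → p ∈ Q := fun ⟨_, _, hQF⟩ => hQF.subset hpF
  have hfin := h𝒯.finite_setOf_mem p
  refine ⟨hfin.subset fun Q hQ => ⟨hQ.1, hmem hQ.2⟩, ?_⟩
  set T := hfin.toFinset with hT
  have hmemT : ∀ {Q}, Q ∈ T ↔ Q ∈ 𝒯 ∧ p ∈ Q := by simp [hT]
  have hncard : ∀ {ε δ : ℝ}, ε ≠ 0 → δ ≠ 0 → {Q | Q ∈ 𝒯 ∧ IsNullFace ε δ Q F}.ncard =
      (T.filter fun Q => OnSide f ε Q ∧ OnSide g δ Q ∨ OnSide g ε Q ∧ OnSide f δ Q).card := by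
    intro ε δ hε hδ
    rw [← Set.ncard_coe_finset]
    congr 1
    ext Q
    rw [Finset.mem_coe, Finset.mem_filter, hmemT, Set.mem_ofPred_eq]
    have hiff := fun hQ hpQ => h𝒯.isNullFace_iff_onSide hP hQ hPF hF hFP hpF hpQ
      (hwedge P hP (hmem hPF)) (hwedge Q hQ hpQ) hε hδ
    exact ⟨fun ⟨hQ, hQF⟩ => ⟨⟨hQ, hmem hQF.isTwoFace⟩, (hiff hQ (hmem hQF.isTwoFace)).1 hQF⟩,
      fun ⟨⟨hQ, hpQ⟩, hside⟩ => ⟨hQ, (hiff hQ hpQ).2 hside⟩⟩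
  have hcount := card_filter_onSide_eq (T := T) (fun Q hQ => hwedge Q (hmemT.1 hQ).1 (hmemT.1 hQ).2)
    (fun Q hQ => (h𝒯.polytope Q (hmemT.1 hQ).1).2)
    ((h𝒯.eventually_exists_mem p).mono fun x ⟨Q, hQ, hpQ, hxQ⟩ => ⟨Q, hmemT.2 ⟨hQ, hpQ⟩, hxQ⟩)
    (fun Q hQ R hR => h𝒯.disjoint Q (hmemT.1 hQ).1 R (hmemT.1 hR).1) hF.linearIndependent
    (hF.left_eq_zero p hpF) (hF.right_eq_zero p hpF)
  simp only [hncard one_ne_zero (neg_ne_zero.2 one_ne_zero), hncard one_ne_zero one_ne_zero,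
    hncard (neg_ne_zero.2 one_ne_zero) (neg_ne_zero.2 one_ne_zero), and_comm (a := OnSide g _ _),
    or_self] at hcount ⊢
  exact hcount

end Tessellations

section Vertices

variable {𝒯 : Set (Set Spacetime)} {P Q F : Set Spacetime} {v : Spacetime}

lemma IsConvexPolytope.finite_hyperfaces (hP : IsConvexPolytope P) :
    {h | IsHyperface P h}.Finite := by
  obtain ⟨A, hA, hA₀, hPA, -⟩ := hP.exists_finite_facet_presentation
  refine (hA.image fun a => {x ∈ P | a x = 0}).subset fun h hh => ?_
  obtain ⟨a, ha, rfl⟩ := (isHyperface_iff_isFacet.1 hh).exists_mem_eq_setOf_eq_zero hA hA₀ hPA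
    hP.convex hP.2
  exact ⟨a, ha, rfl⟩

lemma IsConvexPolytope.finite_twoFaces (hP : IsConvexPolytope P) : {F | IsTwoFace P F}.Finite := by
  refine (hP.finite_hyperfaces.image2 (· ∩ ·) hP.finite_hyperfaces).subset ?_
  rintro F ⟨h, k, hh, hk, -, rfl, -⟩
  exact ⟨h, hh, k, hk, rfl⟩

lemma IsTwoFace.isExtreme (hF : IsTwoFace P F) : IsExtreme ℝ P F := by
  obtain ⟨h, k, hh, hk, -, rfl, -⟩ := hF
  exact hh.1.isExtreme.inter hk.1.isExtreme

lemma IsTwoFace.mem_extremePoints_of_mem (hP : IsTwoFace P F) (hQ : IsTwoFace Q F) (hvF : v ∈ F)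
    (hv : v ∈ P.extremePoints ℝ) : v ∈ Q.extremePoints ℝ := by
  refine hQ.isExtreme.extremePoints_subset_extremePoints ?_
  rw [hP.isExtreme.extremePoints_eq]
  exact ⟨hvF, hv⟩

/-- The excess of a tile `Q` at `v`: the number of its past-future 2d faces which contain `v`, minus
the numbers of its past-past and of its future-future ones. -/
noncomputable def vertexExcess (Q : Set Spacetime) (v : Spacetime) : ℤ :=
  {F | IsNullFace 1 (-1) Q F ∧ v ∈ F}.ncard -
    ({F | IsNullFace 1 1 Q F ∧ v ∈ F}.ncard + {F | IsNullFace (-1) (-1) Q F ∧ v ∈ F}.ncard)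

lemma IsTessellation.finite_setOf_mem_extremePoints (h𝒯 : IsTessellation 𝒯) (v : Spacetime) :
    {Q | Q ∈ 𝒯 ∧ v ∈ Q.extremePoints ℝ}.Finite :=
  (h𝒯.finite_setOf_mem v).subset fun _ hQ => ⟨hQ.1, extremePoints_subset hQ.2⟩

/-- The tiles of a tessellation with vertex `v`. -/
noncomputable def IsTessellation.tilesAt (h𝒯 : IsTessellation 𝒯) (v : Spacetime) :
    Finset (Set Spacetime) :=
  (h𝒯.finite_setOf_mem_extremePoints v).toFinset

lemma IsTessellation.mem_tilesAt (h𝒯 : IsTessellation 𝒯) :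
    Q ∈ h𝒯.tilesAt v ↔ Q ∈ 𝒯 ∧ v ∈ Q.extremePoints ℝ := by
  rw [tilesAt, Set.Finite.mem_toFinset, Set.mem_ofPred_eq]

lemma IsTessellation.exists_sum_ncard_isNullFace_eq (h𝒯 : IsTessellation 𝒯) (v : Spacetime) :
    ∃ 𝓕 : Finset (Set Spacetime), (∀ F ∈ 𝓕, ∃ P ∈ 𝒯, IsTwoFace P F) ∧ ∀ ε δ,
      ∑ Q ∈ h𝒯.tilesAt v, {F | IsNullFace ε δ Q F ∧ v ∈ F}.ncard =
        ∑ F ∈ 𝓕, {Q | Q ∈ 𝒯 ∧ IsNullFace ε δ Q F}.ncard := by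
  classical
  have hfin : (⋃ Q ∈ h𝒯.tilesAt v, {F | IsTwoFace Q F ∧ v ∈ F}).Finite :=
    (h𝒯.tilesAt v).finite_toSet.biUnion fun Q hQ =>
      (h𝒯.polytope Q (h𝒯.mem_tilesAt.1 hQ).1).finite_twoFaces.subset fun F hF => hF.1
  have hmem : ∀ {F}, F ∈ hfin.toFinset ↔ ∃ Q ∈ h𝒯.tilesAt v, IsTwoFace Q F ∧ v ∈ F := by
    simp only [Set.Finite.mem_toFinset, Set.mem_iUnion, exists_prop, Set.mem_ofPred_eq,
      implies_true]
  refine ⟨hfin.toFinset, fun F hF => ?_, fun ε δ => ?_⟩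
  · obtain ⟨P, hP, hPF, -⟩ := hmem.1 hF
    exact ⟨P, (h𝒯.mem_tilesAt.1 hP).1, hPF⟩
  convert Finset.sum_card_bipartiteAbove_eq_sum_card_bipartiteBelow (IsNullFace ε δ)
    (s := h𝒯.tilesAt v) (t := hfin.toFinset) using 2 with Q hQ F hF
  · rw [← Set.ncard_coe_finset]
    congr 1
    ext F
    rw [Finset.mem_coe, Finset.mem_bipartiteAbove, hmem]
    exact ⟨fun h => ⟨⟨Q, hQ, h.1.isTwoFace, h.2⟩, h.1⟩, fun ⟨⟨_, _, _, hvF⟩, h⟩ => ⟨h, hvF⟩⟩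
  · obtain ⟨P, hP, hPF, hvF⟩ := hmem.1 hF
    rw [← Set.ncard_coe_finset]
    congr 1
    ext Q
    rw [Finset.mem_coe, Finset.mem_bipartiteBelow, h𝒯.mem_tilesAt]
    exact ⟨fun h => ⟨⟨h.1, hPF.mem_extremePoints_of_mem h.2.isTwoFace hvF
      (h𝒯.mem_tilesAt.1 hP).2⟩, h.2⟩, fun h => ⟨h.1.1, h.2⟩⟩

theorem IsTessellation.sum_vertexExcess_eq_zero (h𝒯 : IsTessellation 𝒯)
    (hnull : ∀ P ∈ 𝒯, IsNullFaced P) (v : Spacetime) :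
    ∑ Q ∈ h𝒯.tilesAt v, vertexExcess Q v = 0 := by
  obtain ⟨𝓕, h𝓕, hsum⟩ := h𝒯.exists_sum_ncard_isNullFace_eq v
  simp only [vertexExcess, Finset.sum_sub_distrib, Finset.sum_add_distrib, ← Nat.cast_sum, hsum]
  rw [sub_eq_zero, ← Nat.cast_add, ← Finset.sum_add_distrib]
  refine congrArg _ (Finset.sum_congr rfl fun F hF => ?_)
  obtain ⟨P, hP, hPF⟩ := h𝓕 F hF
  exact (h𝒯.finite_and_ncard_isNullFace_eq hnull hP hPF).2

lemma IsTessellation.exists_mem (h𝒯 : IsTessellation 𝒯) : ∃ P, P ∈ 𝒯 := by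
  obtain ⟨P, hP, -⟩ : (0 : Spacetime) ∈ ⋃₀ 𝒯 := h𝒯.cover ▸ Set.mem_univ _
  exact ⟨P, hP⟩

end Vertices

section Simplices

variable {ι E : Type*} [NormedAddCommGroup E] [NormedSpace ℝ E] (b : AffineBasis ι ℝ E)
  {A B : Finset ι} {f : E →ᵃ[ℝ] ℝ} {h : Set E} {i j k : ι}

lemma affineMap_eq_smul_coord (hf : ∀ j ≠ k, f (b j) = 0) : f = f (b k) • b.coord k := by
  refine AffineMap.ext_on b.tot ?_
  rintro _ ⟨j, rfl⟩
  by_cases hj : j = k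
  · simp [hj]
  · simp [hf j hj, b.coord_apply_ne (Ne.symm hj)]

lemma coord_linear_ne_zero [Nontrivial ι] (i : ι) : (b.coord i).linear ≠ 0 := fun h => by
  obtain ⟨j, hj⟩ := exists_ne i
  have := affineMap_linear_sub (b.coord i) (b i) (b j)
  rw [h, b.coord_apply_eq, b.coord_apply_ne hj.symm] at this
  norm_num at this

lemma linearIndependent_smul_coord_linear [Finite ι] (hι : 2 < Nat.card ι) (hij : i ≠ j) {κ μ : ℝ}
    (hκ : κ ≠ 0) (hμ : μ ≠ 0) :
    LinearIndependent ℝ ![(κ • b.coord i).linear, (μ • b.coord j).linear] := by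
  classical
  have := Fintype.ofFinite ι
  obtain ⟨l, -, hl⟩ := Finset.exists_mem_notMem_of_card_lt_card (s := {i, j}) (t := Finset.univ)
    (by rwa [Finset.card_pair hij, Finset.card_univ, ← Nat.card_eq_fintype_card])
  rw [Finset.mem_insert, Finset.mem_singleton, not_or] at hl
  have : Nontrivial ι := ⟨i, j, hij⟩
  refine (LinearIndependent.pair_iff' ?_).2 fun r hr => ?_
  · rw [AffineMap.smul_linear]
    exact smul_ne_zero hκ (coord_linear_ne_zero b i)
  · have hr := LinearMap.congr_fun hr (b j - b l)
    rw [LinearMap.smul_apply, affineMap_linear_sub, affineMap_linear_sub] at hr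
    simp [b.coord_apply_ne hij, b.coord_apply_ne (Ne.symm hl.1), b.coord_apply_ne (Ne.symm hl.2),
      hμ.symm] at hr

lemma sum_coord_linear_eq_zero [Fintype ι] (u : E) : ∑ i, (b.coord i).linear u = 0 := by
  have h := b.sum_coord_apply_eq_one (0 + u)
  simp only [affineMap_apply_add, Finset.sum_add_distrib, b.sum_coord_apply_eq_one] at h
  linarith

/-- The face of the simplex spanned by `b` on which the barycentric coordinates in `A` vanish. -/
def simplexFace (A : Finset ι) : Set E :=
  {x ∈ convexHull ℝ (Set.range b) | ∀ i ∈ A, b.coord i x = 0}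

variable {b}

lemma simplexFace_singleton :
    simplexFace b {i} = {x ∈ convexHull ℝ (Set.range b) | b.coord i x = 0} := by
  simp [simplexFace]

lemma vertex_mem_simplexFace_iff : b j ∈ simplexFace b A ↔ j ∉ A := by
  refine ⟨fun h hj => ?_, fun h => ⟨subset_convexHull ℝ _ ⟨j, rfl⟩, fun i hi => ?_⟩⟩
  · simpa using h.2 j hj
  · exact b.coord_apply_ne (ne_of_mem_of_not_mem hi h)

lemma simplexFace_injective : Function.Injective (simplexFace b) := fun A B h => by
  ext j
  rw [← not_iff_not, ← vertex_mem_simplexFace_iff (b := b), h, vertex_mem_simplexFace_iff]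

lemma simplexFace_inter [DecidableEq ι] :
    simplexFace b A ∩ simplexFace b B = simplexFace b (A ∪ B) := by
  ext x
  simp only [simplexFace, Set.mem_inter_iff, Set.mem_ofPred_eq, Finset.forall_mem_union]
  tauto

lemma onSide_coord (i : ι) : OnSide (b.coord i) 1 (convexHull ℝ (Set.range b)) :=
  onSide_one.2 fun x hx => by
    rw [b.convexHull_eq_nonneg_coord] at hx
    exact hx i

lemma isExtreme_simplexFace (A : Finset ι) :
    IsExtreme ℝ (convexHull ℝ (Set.range b)) (simplexFace b A) := by
  refine ⟨fun x hx => hx.1, fun x hx y hy z hz hzo => ⟨hx, fun i hi => ?_⟩⟩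
  obtain ⟨s, t, hs, ht, hst, rfl⟩ := hzo
  have hzero : s * b.coord i x + t * b.coord i y = 0 := by
    simpa [Convex.combo_affine_apply hst] using hz.2 i hi
  have hx := mul_nonneg hs.le (onSide_one.1 (onSide_coord i) x hx)
  have hy := mul_nonneg ht.le (onSide_one.1 (onSide_coord i) y hy)
  exact (mul_eq_zero.1 (show s * b.coord i x = 0 by linarith)).resolve_left hs.ne'

lemma simplexFace_pair_injOn [DecidableEq ι] (hAB : Disjoint A B) :
    Set.InjOn (fun p : ι × ι => simplexFace b {p.1, p.2}) ↑(A ×ˢ B) := by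
  rintro ⟨i, j⟩ hij ⟨k, l⟩ hkl e
  simp only [Finset.coe_product, Set.mem_prod, Finset.mem_coe] at hij hkl
  have e : ({i, j} : Finset ι) = {k, l} := simplexFace_injective e
  have hi : i = k ∨ i = l := by simpa [e] using Finset.mem_insert_self i {j}
  have hj : j = k ∨ j = l := by
    simpa [e] using Finset.mem_insert_of_mem (a := j) (b := i) (Finset.mem_singleton_self j)
  have hil : i ≠ l := fun h => Finset.disjoint_left.1 hAB hij.1 (h ▸ hkl.2)
  have hjk : j ≠ k := fun h => Finset.disjoint_left.1 hAB hkl.1 (h ▸ hij.2)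
  rw [hi.resolve_right hil, hj.resolve_left hjk]

variable (b) in
lemma interior_convexHull_range_nonempty [Finite ι] :
    (interior (convexHull ℝ (Set.range b))).Nonempty :=
  have := b.finiteDimensional
  interior_convexHull_nonempty_iff_affineSpan_eq_top.2 b.tot

lemma simplexFace_eq_convexHull [Finite ι] :
    simplexFace b A = convexHull ℝ (b '' (A : Set ι)ᶜ) := by
  classical
  have := Fintype.ofFinite ι
  ext x
  constructor
  · rintro ⟨hx, hA⟩
    rw [b.convexHull_eq_nonneg_coord] at hx
    have hzero : ∀ i ∈ Finset.univ, i ∉ Aᶜ → b.coord i x = 0 := fun i _ hi =>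
      hA i (by simpa using hi)
    have hsum : ∑ i ∈ Aᶜ, b.coord i x • b i = x := by
      rw [Finset.sum_subset (Finset.subset_univ _) fun i hi hi' => by
        rw [hzero i hi hi', zero_smul], b.linear_combination_coord_eq_self]
    rw [← hsum]
    refine (convex_convexHull ℝ _).sum_mem (fun i _ => hx i) ?_ fun i hi => ?_
    · rw [Finset.sum_subset (Finset.subset_univ _) hzero, b.sum_coord_apply_eq_one]
    · exact subset_convexHull ℝ _ (Set.mem_image_of_mem b (by simpa using hi))
  · refine fun hx => ⟨convexHull_mono (Set.image_subset_range _ _) hx, fun i hi => ?_⟩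
    have hconv : Convex ℝ (b.coord i ⁻¹' {0}) := (convex_singleton 0).affine_preimage _
    refine convexHull_min ?_ hconv hx
    rintro _ ⟨j, hj, rfl⟩
    exact b.coord_apply_ne (ne_of_mem_of_not_mem hi hj)

lemma finrank_vectorSpan_simplexFace [Fintype ι] {d : ℕ}
    (hA : A.card + (d + 1) = Fintype.card ι) :
    finrank ℝ (vectorSpan ℝ (simplexFace b A)) = d := by
  classical
  rw [simplexFace_eq_convexHull, ← direction_affineSpan, affineSpan_convexHull,
    direction_affineSpan, ← Finset.coe_compl, ← Finset.coe_image]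
  refine b.ind.finrank_vectorSpan_image_finset ?_
  rw [Finset.card_compl]
  omega

lemma isFacet_convexHull_range_iff [Finite ι] [Nontrivial ι] :
    IsFacet (convexHull ℝ (Set.range b)) h ↔ ∃ i, h = simplexFace b {i} := by
  have := Fintype.ofFinite ι
  have := b.finiteDimensional
  constructor
  · intro hh
    obtain ⟨_, ⟨i, rfl⟩, hi⟩ := hh.exists_mem_eq_setOf_eq_zero (Set.finite_range b.coord)
      (Set.forall_mem_range.2 (coord_linear_ne_zero b))
      (fun x => by simp [b.convexHull_eq_nonneg_coord]) (convex_convexHull ℝ _)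
      (interior_convexHull_range_nonempty b)
    exact ⟨i, by rw [hi, simplexFace_singleton]⟩
  · rintro ⟨i, rfl⟩
    obtain ⟨j, hj⟩ := exists_ne i
    refine ⟨?_, ⟨b j, vertex_mem_simplexFace_iff.2 (by simpa using hj)⟩, ?_⟩
    · rw [simplexFace_singleton]
      exact isExposed_setOf_eq_zero (onSide_coord i)
    · have hcard := b.card_eq_finrank_add_one
      have := Fintype.one_lt_card (α := ι)
      rw [finrank_vectorSpan_simplexFace (d := finrank ℝ E - 1)]
      · omega
      · rw [Finset.card_singleton]
        omega

lemma vertex_mem_extremePoints [Finite ι] (j : ι) :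
    b j ∈ (convexHull ℝ (Set.range b)).extremePoints ℝ := by
  classical
  have := Fintype.ofFinite ι
  rw [← isExtreme_singleton]
  convert isExtreme_simplexFace (b := b) {j}ᶜ
  rw [simplexFace_eq_convexHull, Finset.coe_compl, compl_compl, Finset.coe_singleton,
    Set.image_singleton, convexHull_singleton]

end Simplices

section NullSides

variable {E : Type*} [NormedAddCommGroup E] [NormedSpace ℝ E] {ε : ℝ}

lemma onSide_iff_pos {P : Set E} {f : E →ᵃ[ℝ] ℝ} (hP : (interior P).Nonempty) (hf : f.linear ≠ 0)
    (hfP : OnSide f 1 P) (hε : ε ≠ 0) : OnSide f ε P ↔ 0 < ε := by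
  refine ⟨fun h => ?_, fun h => by simpa using (onSide_mul_of_pos (ε := 1) h).2 hfP⟩
  by_contra hneg
  have hneg : 0 < -ε := neg_pos.2 (lt_of_le_of_ne (not_lt.1 hneg) hε)
  exact hf (h.linear_eq_zero_of_neg hP hε (by simpa using (onSide_mul_of_pos (ε := 1) hneg).2 hfP))

variable {P h : Set Spacetime} {f : Spacetime →ᵃ[ℝ] ℝ}

lemma IsHyperface.isNullHyperface_iff (hh : IsHyperface P h) (hf : IsNullCoordinate f)
    (hfh : ∀ x ∈ h, f x = 0) : IsNullHyperface ε P h ↔ OnSide f ε P := by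
  refine ⟨?_, fun hfP => ⟨hh, f, hf, hfh, hfP⟩⟩
  rintro ⟨-, g, hg, hgh, hgP⟩
  have hfacet := isHyperface_iff_isFacet.1 hh
  obtain ⟨κ, -, rfl⟩ := exists_eq_smul_of_forall_eq_zero hfacet.finrank_add_one hfacet.nonempty
    hg.linear_ne_zero hf.linear_ne_zero hgh hfh
  rwa [onSide_smul, mul_comm, onSide_mul_of_pos (hf.pos_of_eq_smul hg rfl)] at hgP

lemma IsHyperface.exists_isNullCoordinate_smul (hh : IsHyperface P h) (hP : (interior P).Nonempty)
    (hnull : LiesInNullHyperplane h) (hf : f.linear ≠ 0) (hfP : OnSide f 1 P)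
    (hfh : ∀ x ∈ h, f x = 0) : ∃ κ : ℝ, κ ≠ 0 ∧ IsNullCoordinate (κ • f) ∧
      ∀ ε ≠ 0, IsNullHyperface ε P h ↔ 0 < ε * κ := by
  have hfacet := isHyperface_iff_isFacet.1 hh
  obtain ⟨g, hg, hgh⟩ := liesInNullHyperplane_iff.1 hnull
  obtain ⟨κ, hκ, rfl⟩ := exists_eq_smul_of_forall_eq_zero hfacet.finrank_add_one hfacet.nonempty
    hg.linear_ne_zero hf hgh hfh
  refine ⟨κ, hκ, hg, fun ε hε => ?_⟩
  rw [hh.isNullHyperface_iff hg hgh, onSide_smul, onSide_iff_pos hP hf hfP (mul_ne_zero hε hκ)]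

end NullSides

section NullFacedSimplices

variable {b : AffineBasis (Fin 5) ℝ Spacetime} {h k F : Set Spacetime} {ε δ : ℝ}

lemma isHyperface_convexHull_range_iff :
    IsHyperface (convexHull ℝ (Set.range b)) h ↔ ∃ i, h = simplexFace b {i} :=
  isHyperface_iff_isFacet.trans isFacet_convexHull_range_iff

lemma isHyperface_simplexFace (i : Fin 5) :
    IsHyperface (convexHull ℝ (Set.range b)) (simplexFace b {i}) :=
  isHyperface_convexHull_range_iff.2 ⟨i, rfl⟩

lemma isFaceBetween_convexHull_range_iff : IsFaceBetween (convexHull ℝ (Set.range b)) h k F ↔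
    ∃ i j, i ≠ j ∧ h = simplexFace b {i} ∧ k = simplexFace b {j} ∧ F = simplexFace b {i, j} := by
  constructor
  · rintro ⟨hh, hk, hne, rfl, -⟩
    obtain ⟨i, rfl⟩ := isHyperface_convexHull_range_iff.1 hh
    obtain ⟨j, rfl⟩ := isHyperface_convexHull_range_iff.1 hk
    exact ⟨i, j, fun e => hne (by rw [e]), rfl, rfl, simplexFace_inter⟩
  · rintro ⟨i, j, hij, rfl, rfl, rfl⟩
    refine ⟨isHyperface_simplexFace i, isHyperface_simplexFace j, fun e => hij ?_,
      by rw [simplexFace_inter]; rfl, finrank_vectorSpan_simplexFace ?_⟩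
    · simpa using simplexFace_injective e
    · rw [Finset.card_pair hij, Fintype.card_fin]

open Classical in
/-- The indices of the vertices of a simplex which are opposite to a null hyperface of sign `ε`. -/
noncomputable def nullSides (b : AffineBasis (Fin 5) ℝ Spacetime) (ε : ℝ) : Finset (Fin 5) :=
  {i | IsNullHyperface ε (convexHull ℝ (Set.range b)) (simplexFace b {i})}

lemma mem_nullSides {i : Fin 5} : i ∈ nullSides b ε ↔
    IsNullHyperface ε (convexHull ℝ (Set.range b)) (simplexFace b {i}) := by
  simp [nullSides]

lemma isNullHyperface_convexHull_range_iff : IsNullHyperface ε (convexHull ℝ (Set.range b)) h ↔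
    ∃ i ∈ nullSides b ε, h = simplexFace b {i} := by
  simp only [mem_nullSides]
  refine ⟨fun hh => ?_, by rintro ⟨i, hi, rfl⟩; exact hi⟩
  obtain ⟨i, rfl⟩ := isHyperface_convexHull_range_iff.1 hh.1
  exact ⟨i, hh, rfl⟩

lemma isNullFace_convexHull_range_iff : IsNullFace ε δ (convexHull ℝ (Set.range b)) F ↔
    ∃ i ∈ nullSides b ε, ∃ j ∈ nullSides b δ, i ≠ j ∧ F = simplexFace b {i, j} := by
  simp only [IsNullFace, isFaceBetween_convexHull_range_iff, mem_nullSides]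
  constructor
  · rintro ⟨_, _, ⟨i, j, hij, rfl, rfl, rfl⟩, hi, hj⟩
    exact ⟨i, hi, j, hj, hij, rfl⟩
  · rintro ⟨i, hi, j, hj, hij, rfl⟩
    exact ⟨_, _, ⟨i, j, hij, rfl, rfl, rfl⟩, hi, hj⟩

lemma exists_isNullCoordinate_smul_coord (hb : IsNullFaced (convexHull ℝ (Set.range b))) :
    ∃ κ : Fin 5 → ℝ, (∀ i, κ i ≠ 0) ∧ (∀ i, IsNullCoordinate (κ i • b.coord i)) ∧
      ∀ i, ∀ ε ≠ 0, i ∈ nullSides b ε ↔ 0 < ε * κ i := by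
  choose κ hκ using fun i => (isHyperface_simplexFace (b := b) i).exists_isNullCoordinate_smul
    (interior_convexHull_range_nonempty b) (hb _ (isHyperface_simplexFace i))
    (coord_linear_ne_zero b i) (onSide_coord i) fun x hx => hx.2 i (Finset.mem_singleton_self i)
  simp only [mem_nullSides]
  exact ⟨κ, fun i => (hκ i).1, fun i => (hκ i).2.1, fun i => (hκ i).2.2⟩

lemma nullSides_neg_one (hb : IsNullFaced (convexHull ℝ (Set.range b))) :
    nullSides b (-1) = (nullSides b 1)ᶜ := by
  obtain ⟨κ, hκ, -, hmem⟩ := exists_isNullCoordinate_smul_coord hb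
  ext i
  rw [Finset.mem_compl, hmem i _ (by norm_num), hmem i _ one_ne_zero, one_mul, neg_one_mul,
    neg_pos, not_lt]
  exact ⟨le_of_lt, fun h => lt_of_le_of_ne h (hκ i)⟩

/-- A null normal of the hyperface opposite to `b j` pairs with a definite sign with the null
normals of all other hyperfaces, whereas the barycentric coordinates have constant sum. -/
lemma exists_mem_nullSides_ne (hb : IsNullFaced (convexHull ℝ (Set.range b))) (hε : ε ≠ 0)
    (j : Fin 5) : ∃ i ∈ nullSides b ε, i ≠ j := by
  obtain ⟨κ, hκ, hnull, hmem⟩ := exists_isNullCoordinate_smul_coord hb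
  obtain ⟨u, hju, hu⟩ := (hnull j).exists_linear_eq_zero_and_pos
  have hpos : ∀ i ≠ j, 0 < κ i * (b.coord i).linear u := fun i hij =>
    hu _ (hnull i) (linearIndependent_smul_coord_linear b (by simp) hij.symm (hκ j) (hκ i))
  by_contra! hall
  have hneg : ∀ i ∈ Finset.univ.erase j, ε * (b.coord i).linear u < 0 := fun i hi => by
    have hij := Finset.ne_of_mem_erase hi
    have hle : ε * κ i ≤ 0 := not_lt.1 fun h => hij (hall i ((hmem i ε hε).2 h))
    have := hpos i hij
    nlinarith [mul_pos this (mul_self_pos.2 hε), mul_self_pos.2 (hκ i), mul_self_pos.2 hε]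
  have hsum := sum_coord_linear_eq_zero b u
  have hj : (b.coord j).linear u = 0 := by simpa [hκ j] using hju
  rw [← Finset.add_sum_erase _ _ (Finset.mem_univ j), hj, zero_add] at hsum
  have := Finset.sum_neg hneg ((Finset.univ_nontrivial).erase_nonempty)
  rw [← Finset.mul_sum, hsum, mul_zero] at this
  exact this.false

lemma one_lt_card_nullSides (hb : IsNullFaced (convexHull ℝ (Set.range b))) (hε : ε ≠ 0) :
    1 < (nullSides b ε).card := by
  obtain ⟨i, hi, -⟩ := exists_mem_nullSides_ne hb hε 0
  obtain ⟨j, hj, hji⟩ := exists_mem_nullSides_ne hb hε i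
  exact Finset.one_lt_card.2 ⟨j, hj, i, hi, hji⟩

lemma card_nullSides (hb : IsNullFaced (convexHull ℝ (Set.range b))) :
    (nullSides b 1).card = 2 ∧ (nullSides b (-1)).card = 3 ∨
      (nullSides b 1).card = 3 ∧ (nullSides b (-1)).card = 2 := by
  have h₁ := one_lt_card_nullSides hb one_ne_zero
  have h₂ := one_lt_card_nullSides hb (ε := -1) (by norm_num)
  have hcard := (nullSides b 1).card_add_card_compl
  rw [← nullSides_neg_one hb, Fintype.card_fin] at hcard
  omega

lemma ncard_isNullFace_self_and_mem (V : Finset (Fin 5)) :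
    {F | IsNullFace ε ε (convexHull ℝ (Set.range b)) F ∧ ∀ i ∈ V, b i ∈ F}.ncard =
      (nullSides b ε \ V).card.choose 2 := by
  rw [← Finset.card_powersetCard, ← Set.ncard_coe_finset,
    ← Set.ncard_image_of_injective _ (simplexFace_injective (b := b))]
  congr 1
  ext F
  simp only [Set.mem_ofPred_eq, isNullFace_convexHull_range_iff, Set.mem_image, Finset.mem_coe,
    Finset.mem_powersetCard, Finset.card_eq_two, Finset.subset_sdiff]
  constructor
  · rintro ⟨⟨i, hi, j, hj, hij, rfl⟩, hV⟩
    refine ⟨{i, j}, ⟨⟨by simp [Finset.insert_subset_iff, hi, hj], ?_⟩, i, j, hij, rfl⟩, rfl⟩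
    exact Finset.disjoint_right.2 fun l hl => vertex_mem_simplexFace_iff.1 (hV l hl)
  · rintro ⟨_, ⟨⟨hsub, hdisj⟩, i, j, hij, rfl⟩, rfl⟩
    rw [Finset.insert_subset_iff, Finset.singleton_subset_iff] at hsub
    exact ⟨⟨i, hsub.1, j, hsub.2, hij, rfl⟩, fun l hl =>
      vertex_mem_simplexFace_iff.2 (Finset.disjoint_right.1 hdisj hl)⟩

lemma ncard_isNullFace_neg_and_mem (hb : IsNullFaced (convexHull ℝ (Set.range b)))
    (V : Finset (Fin 5)) :
    {F | IsNullFace 1 (-1) (convexHull ℝ (Set.range b)) F ∧ ∀ i ∈ V, b i ∈ F}.ncard =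
      (nullSides b 1 \ V).card * (nullSides b (-1) \ V).card := by
  have hdisj : Disjoint (nullSides b 1) (nullSides b (-1)) :=
    nullSides_neg_one hb ▸ disjoint_compl_right
  have hinj := simplexFace_pair_injOn (b := b)
    (hdisj.mono (Finset.sdiff_subset (t := V)) (Finset.sdiff_subset (t := V)))
  rw [← Finset.card_product, ← Set.ncard_coe_finset, ← hinj.ncard_image]
  congr 1
  ext F
  simp only [Set.mem_ofPred_eq, isNullFace_convexHull_range_iff, Set.mem_image, Prod.exists,
    Finset.coe_product, Set.mem_prod, Finset.mem_coe, Finset.mem_sdiff]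
  constructor
  · rintro ⟨⟨i, hi, j, hj, -, rfl⟩, hV⟩
    have hV := fun l hl => vertex_mem_simplexFace_iff.1 (hV l hl)
    exact ⟨i, j, ⟨⟨hi, fun h => hV i h (by simp)⟩, hj, fun h => hV j h (by simp)⟩, rfl⟩
  · rintro ⟨i, j, ⟨⟨hi, hiV⟩, hj, hjV⟩, rfl⟩
    refine ⟨⟨i, hi, j, hj, fun e => Finset.disjoint_left.1 hdisj hi (e ▸ hj), rfl⟩, fun l hl => ?_⟩
    rw [vertex_mem_simplexFace_iff, Finset.mem_insert, Finset.mem_singleton, not_or]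
    exact ⟨ne_of_mem_of_not_mem hl hiV, ne_of_mem_of_not_mem hl hjV⟩

lemma ncard_isTwoFace_convexHull_range :
    {F | IsTwoFace (convexHull ℝ (Set.range b)) F}.ncard = 10 := by
  have himage : {F | IsTwoFace (convexHull ℝ (Set.range b)) F} =
      simplexFace b '' (Finset.univ.powersetCard 2 : Finset (Finset (Fin 5))) := by
    ext F
    simp only [IsTwoFace, isFaceBetween_convexHull_range_iff, Set.mem_ofPred_eq, Set.mem_image,
      Finset.mem_coe, Finset.mem_powersetCard_univ, Finset.card_eq_two]
    constructor
    · rintro ⟨_, _, i, j, hij, -, -, rfl⟩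
      exact ⟨_, ⟨i, j, hij, rfl⟩, rfl⟩
    · rintro ⟨_, ⟨i, j, hij, rfl⟩, rfl⟩
      exact ⟨_, _, i, j, hij, rfl, rfl, rfl⟩
  rw [himage, Set.ncard_image_of_injective _ simplexFace_injective, Set.ncard_coe_finset,
    Finset.card_powersetCard, Finset.card_univ, Fintype.card_fin]
  rfl

lemma ncard_setOf_exists_eq_simplexFace_singleton (S : Finset (Fin 5)) :
    {h | ∃ i ∈ S, h = simplexFace b {i}}.ncard = S.card := by
  have himage : {h | ∃ i ∈ S, h = simplexFace b {i}} = (fun i => simplexFace b {i}) '' S := by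
    ext h
    simp [eq_comm]
  have hinj : Function.Injective fun i => simplexFace b {i} := fun _ _ e =>
    Finset.singleton_injective (simplexFace_injective e)
  rw [himage, Set.ncard_image_of_injective _ hinj, Set.ncard_coe_finset]

lemma ncard_isHyperface_convexHull_range :
    {h | IsHyperface (convexHull ℝ (Set.range b)) h}.ncard = 5 := by
  simpa [isHyperface_convexHull_range_iff] using
    ncard_setOf_exists_eq_simplexFace_singleton (b := b) Finset.univ

lemma ncard_isNullHyperface_convexHull_range :
    {h | IsNullHyperface ε (convexHull ℝ (Set.range b)) h}.ncard = (nullSides b ε).card := by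
  simp only [isNullHyperface_convexHull_range_iff, ncard_setOf_exists_eq_simplexFace_singleton]

lemma xor_isNullHyperface (hb : IsNullFaced (convexHull ℝ (Set.range b)))
    (hh : IsHyperface (convexHull ℝ (Set.range b)) h) :
    Xor (IsNullHyperface 1 (convexHull ℝ (Set.range b)) h)
      (IsNullHyperface (-1) (convexHull ℝ (Set.range b)) h) := by
  obtain ⟨i, rfl⟩ := isHyperface_convexHull_range_iff.1 hh
  rw [← mem_nullSides, ← mem_nullSides, nullSides_neg_one hb, Finset.mem_compl]
  by_cases hi : i ∈ nullSides b 1 <;> simp [hi]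

lemma vertexExcess_convexHull_range (hb : IsNullFaced (convexHull ℝ (Set.range b))) (j : Fin 5) :
    vertexExcess (convexHull ℝ (Set.range b)) (b j) =
      (nullSides b 1 \ {j}).card * (nullSides b (-1) \ {j}).card -
        ((nullSides b 1 \ {j}).card.choose 2 + (nullSides b (-1) \ {j}).card.choose 2) := by
  have h₁ := ncard_isNullFace_self_and_mem (b := b) (ε := 1) {j}
  have h₂ := ncard_isNullFace_self_and_mem (b := b) (ε := -1) {j}
  have h₃ := ncard_isNullFace_neg_and_mem hb {j}
  simp only [Finset.mem_singleton, forall_eq] at h₁ h₂ h₃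
  rw [vertexExcess, h₁, h₂, h₃, Nat.cast_mul]

lemma card_nullSides_sdiff_add (hb : IsNullFaced (convexHull ℝ (Set.range b))) (j : Fin 5) :
    (nullSides b 1 \ {j}).card + (nullSides b (-1) \ {j}).card = 4 := by
  have hdisj : Disjoint (nullSides b 1) (nullSides b (-1)) :=
    nullSides_neg_one hb ▸ disjoint_compl_right
  rw [← Finset.card_union_of_disjoint
      (hdisj.mono (Finset.sdiff_subset (t := {j})) (Finset.sdiff_subset (t := {j}))),
    ← Finset.union_sdiff_distrib, nullSides_neg_one hb, Finset.union_compl,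
    Finset.card_univ_sdiff, Fintype.card_fin, Finset.card_singleton]

lemma card_nullSides_sdiff_pos (hb : IsNullFaced (convexHull ℝ (Set.range b))) (hε : ε ≠ 0)
    (j : Fin 5) : 0 < (nullSides b ε \ {j}).card := by
  obtain ⟨i, hi, hij⟩ := exists_mem_nullSides_ne hb hε j
  exact Finset.card_pos.2 ⟨i, by simp [hi, hij]⟩

lemma vertexExcess_convexHull_range_nonneg (hb : IsNullFaced (convexHull ℝ (Set.range b)))
    (j : Fin 5) : 0 ≤ vertexExcess (convexHull ℝ (Set.range b)) (b j) := by
  rw [vertexExcess_convexHull_range hb]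
  have h₁ := card_nullSides_sdiff_pos hb one_ne_zero j
  have h₂ := card_nullSides_sdiff_pos hb (ε := -1) (by norm_num) j
  have hsum := card_nullSides_sdiff_add hb j
  generalize (nullSides b 1 \ {j}).card = p at *
  have hq : (nullSides b (-1) \ {j}).card = 4 - p := by omega
  rw [hq]
  have hp : p ≤ 3 := by omega
  interval_cases p <;> decide

lemma exists_vertexExcess_convexHull_range_pos
    (hb : IsNullFaced (convexHull ℝ (Set.range b))) :
    ∃ j, 0 < vertexExcess (convexHull ℝ (Set.range b)) (b j) := by
  obtain ⟨j, hj⟩ : ∃ j, (nullSides b 1 \ {j}).card = 2 := by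
    simp only [Finset.sdiff_singleton_eq_erase]
    obtain ⟨h₁, h₂⟩ | ⟨h₁, -⟩ := card_nullSides hb
    · obtain ⟨j, hj⟩ : (nullSides b (-1)).Nonempty := Finset.card_pos.1 (by omega)
      rw [nullSides_neg_one hb, Finset.mem_compl] at hj
      exact ⟨j, by rw [Finset.erase_eq_of_notMem hj, h₁]⟩
    · obtain ⟨j, hj⟩ : (nullSides b 1).Nonempty := Finset.card_pos.1 (by omega)
      exact ⟨j, by rw [Finset.card_erase_of_mem hj, h₁]⟩
  have hsum := card_nullSides_sdiff_add hb j
  have hj' : (nullSides b (-1) \ {j}).card = 2 := by omega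
  exact ⟨j, by rw [vertexExcess_convexHull_range hb, hj, hj']; decide⟩

lemma IsNullFacedSimplex.exists_affineBasis {P : Set Spacetime} (hP : IsNullFacedSimplex P) :
    ∃ b : AffineBasis (Fin 5) ℝ Spacetime,
      P = convexHull ℝ (Set.range b) ∧ IsNullFaced (convexHull ℝ (Set.range b)) := by
  obtain ⟨v, hv, rfl, hnull⟩ := hP
  exact ⟨⟨v, hv, hv.affineSpan_eq_top_iff_card_eq_finrank_add_one.2 (by simp)⟩, rfl, hnull⟩

theorem IsNullFacedSimplex.causalStructure {P : Set Spacetime} (hP : IsNullFacedSimplex P) :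
    {h | IsHyperface P h}.ncard = 5 ∧
    (∀ h, IsHyperface P h → Xor (IsPastHyperface P h) (IsFutureHyperface P h)) ∧
    {F | IsTwoFace P F}.ncard = 10 ∧
    {F | IsPastFutureFace P F}.ncard = 6 ∧
    (({h | IsPastHyperface P h}.ncard = 2 ∧ {h | IsFutureHyperface P h}.ncard = 3 ∧
        {F | IsPastPastFace P F}.ncard = 1 ∧ {F | IsFutureFutureFace P F}.ncard = 3) ∨
      ({h | IsPastHyperface P h}.ncard = 3 ∧ {h | IsFutureHyperface P h}.ncard = 2 ∧
        {F | IsPastPastFace P F}.ncard = 3 ∧ {F | IsFutureFutureFace P F}.ncard = 1)) := by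
  obtain ⟨b, rfl, hb⟩ := hP.exists_affineBasis
  have hself (ε : ℝ) := ncard_isNullFace_self_and_mem (b := b) (ε := ε) ∅
  have hmixed := ncard_isNullFace_neg_and_mem hb ∅
  simp only [Finset.notMem_empty, false_imp_iff, forall_const, and_true,
    Finset.sdiff_empty] at hself hmixed
  simp only [isPastHyperface_iff, isFutureHyperface_iff, isPastPastFace_iff,
    isPastFutureFace_iff, isFutureFutureFace_iff, hself, hmixed,
    ncard_isNullHyperface_convexHull_range]
  refine ⟨ncard_isHyperface_convexHull_range, fun h hh => xor_isNullHyperface hb hh,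
    ncard_isTwoFace_convexHull_range, ?_, ?_⟩ <;>
  rcases card_nullSides hb with ⟨h₁, h₂⟩ | ⟨h₁, h₂⟩ <;> simp [h₁, h₂]

theorem not_exists_isTessellation_of_isNullFacedSimplex :
    ¬ ∃ 𝒯, IsTessellation 𝒯 ∧ ∀ P ∈ 𝒯, IsNullFacedSimplex P := by
  rintro ⟨𝒯, h𝒯, hsimplex⟩
  have hnull : ∀ P ∈ 𝒯, IsNullFaced P := fun P hP => (hsimplex P hP).choose_spec.2.2
  obtain ⟨P, hP⟩ := h𝒯.exists_mem
  obtain ⟨b, rfl, hb⟩ := (hsimplex P hP).exists_affineBasis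
  obtain ⟨j, hj⟩ := exists_vertexExcess_convexHull_range_pos hb
  have hnonneg : ∀ Q ∈ h𝒯.tilesAt (b j), 0 ≤ vertexExcess Q (b j) := fun Q hQ => by
    obtain ⟨hQ, hv⟩ := h𝒯.mem_tilesAt.1 hQ
    obtain ⟨b', rfl, hb'⟩ := (hsimplex Q hQ).exists_affineBasis
    obtain ⟨i, hi⟩ := extremePoints_convexHull_subset hv
    exact hi ▸ vertexExcess_convexHull_range_nonneg hb' i
  exact (Finset.sum_pos' hnonneg
    ⟨_, h𝒯.mem_tilesAt.2 ⟨hP, vertex_mem_extremePoints j⟩, hj⟩).ne'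
      (h𝒯.sum_vertexExcess_eq_zero hnull (b j))

end NullFacedSimplices

section Bipyramids

variable {κ E : Type*} [NormedAddCommGroup E] [NormedSpace ℝ E] {P h : Set E}
  {up down : AffineBasis (Option κ) ℝ E} {i k : κ}

/-- The bipyramids over a simplex. The bases `up` and `down` consist of one of the two apices, with
index `none`, and of the vertices of the simplex. The apices lie on different sides of the
hyperplane of the simplex, and the segment between them crosses the interior of the simplex. -/
structure IsBipyramid (P : Set E) (up down : AffineBasis (Option κ) ℝ E) : Prop where
  base : ∀ k, up (some k) = down (some k)
  coord_none_neg : up.coord none (down none) < 0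
  coord_some_pos : ∀ k, 0 < up.coord (some k) (down none)
  eq_convexHull : P = convexHull ℝ (Set.range up ∪ Set.range down)

/-- The side of a bipyramid `P` through the apex `e none` and all vertices of the base other than
`e (some k)`. -/
def bipyramidSide (P : Set E) (e : AffineBasis (Option κ) ℝ E) (k : κ) : Set E :=
  {x ∈ P | e.coord (some k) x = 0}

namespace IsBipyramid

lemma coord_none_eq (hP : IsBipyramid P up down) :
    up.coord none = up.coord none (down none) • down.coord none := by
  refine affineMap_eq_smul_coord down fun j hj => ?_
  obtain ⟨k, rfl⟩ := Option.ne_none_iff_exists'.1 hj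
  rw [← hP.base, up.coord_apply_ne (Option.some_ne_none k).symm]

lemma coord_some_eq (hP : IsBipyramid P up down) (k : κ) : down.coord (some k) =
    up.coord (some k) + down.coord (some k) (up none) • up.coord none := by
  refine AffineMap.ext_on up.tot ?_
  rintro _ ⟨_ | j, rfl⟩
  · simp
  · simp only [AffineMap.coe_add, AffineMap.coe_smul, Pi.add_apply, Pi.smul_apply, smul_eq_mul,
      up.coord_apply_ne (Option.some_ne_none j).symm, mul_zero, add_zero]
    conv_lhs => rw [hP.base j]
    classical simp only [AffineBasis.coord_apply]

lemma symm (hP : IsBipyramid P up down) : IsBipyramid P down up where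
  base k := (hP.base k).symm
  coord_none_neg := by
    have hone := congrArg (fun f => f (up none)) hP.coord_none_eq
    simp only [up.coord_apply_eq, AffineMap.coe_smul, Pi.smul_apply, smul_eq_mul] at hone
    exact neg_of_mul_pos_right (hone ▸ one_pos) hP.coord_none_neg.le
  coord_some_pos k := by
    have hzero := congrArg (fun f => f (down none)) (hP.coord_some_eq k)
    simp only [down.coord_apply_ne (Option.some_ne_none k), AffineMap.coe_add, AffineMap.coe_smul,
      Pi.add_apply, Pi.smul_apply, smul_eq_mul] at hzero
    by_contra! hle
    linarith [hP.coord_some_pos k, mul_nonneg_of_nonpos_of_nonpos hle hP.coord_none_neg.le]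
  eq_convexHull := by rw [hP.eq_convexHull, Set.union_comm]

lemma convexHull_subset (hP : IsBipyramid P up down) : convexHull ℝ (Set.range up) ⊆ P := by
  rw [hP.eq_convexHull]
  exact convexHull_mono Set.subset_union_left

lemma convex (hP : IsBipyramid P up down) : Convex ℝ P :=
  hP.eq_convexHull ▸ convex_convexHull ℝ _

lemma interior_nonempty [Finite κ] (hP : IsBipyramid P up down) : (interior P).Nonempty :=
  (interior_convexHull_range_nonempty up).mono (interior_mono hP.convexHull_subset)

lemma onSide_coord_some (hP : IsBipyramid P up down) (k : κ) :
    OnSide (up.coord (some k)) 1 P := by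
  have hconv : Convex ℝ (up.coord (some k) ⁻¹' Set.Ici 0) := (convex_Ici 0).affine_preimage _
  have hup : ∀ i, 0 ≤ up.coord (some k) (up i) := fun i =>
    onSide_one.1 (onSide_coord (b := up) (some k)) _ (subset_convexHull ℝ _ ⟨i, rfl⟩)
  rw [onSide_one, hP.eq_convexHull]
  refine fun x hx => convexHull_min ?_ hconv hx
  rintro _ (⟨i, rfl⟩ | ⟨_ | j, rfl⟩)
  · exact hup i
  · exact (hP.coord_some_pos k).le
  · exact hP.base j ▸ hup (some j)

lemma mem_iff (hP : IsBipyramid P up down) {x : E} :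
    x ∈ P ↔ ∀ k, 0 ≤ up.coord (some k) x ∧ 0 ≤ down.coord (some k) x := by
  refine ⟨fun hx k => ⟨onSide_one.1 (hP.onSide_coord_some k) x hx,
    onSide_one.1 (hP.symm.onSide_coord_some k) x hx⟩, fun hx => ?_⟩
  obtain hnone | hnone := le_total 0 (up.coord none x)
  · refine hP.convexHull_subset ?_
    rw [up.convexHull_eq_nonneg_coord]
    rintro (_ | k)
    exacts [hnone, (hx k).1]
  · refine hP.symm.convexHull_subset ?_
    rw [down.convexHull_eq_nonneg_coord]
    rintro (_ | k)
    · have heq : down.coord none x = down.coord none (up none) * up.coord none x := by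
        conv_lhs => rw [hP.symm.coord_none_eq]
        rfl
      exact heq ▸ mul_nonneg_of_nonpos_of_nonpos hP.symm.coord_none_neg.le hnone
    · exact (hx k).2

lemma vertex_mem_side_iff (hP : IsBipyramid P up down) {j : Option κ} :
    up j ∈ bipyramidSide P up k ↔ j ≠ some k := by
  constructor
  · rintro ⟨-, hj⟩ rfl
    simp at hj
  · exact fun hj => ⟨hP.convexHull_subset (subset_convexHull ℝ _ ⟨j, rfl⟩),
      up.coord_apply_ne hj.symm⟩

lemma apex_notMem_side (hP : IsBipyramid P up down) : up none ∉ bipyramidSide P down k :=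
  fun h => (hP.symm.coord_some_pos k).ne' h.2

lemma side_injective (hP : IsBipyramid P up down) : Function.Injective (bipyramidSide P up) :=
  fun i k hik => by
    by_contra hne
    have hmem := hP.vertex_mem_side_iff.2 fun h => hne (Option.some_injective κ h)
    exact hP.vertex_mem_side_iff.1 (hik.symm ▸ hmem : up (some i) ∈ bipyramidSide P up i) rfl

lemma simplexFace_subset_side (hP : IsBipyramid P up down) {A : Finset (Option κ)}
    (hk : some k ∈ A) : simplexFace up A ⊆ bipyramidSide P up k :=
  fun _ hx => ⟨hP.convexHull_subset hx.1, hx.2 _ hk⟩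

lemma isFacet_side [Finite κ] (hP : IsBipyramid P up down) (k : κ) :
    IsFacet P (bipyramidSide P up k) := by
  have := up.finiteDimensional
  have : Nontrivial (Option κ) := ⟨none, some k, (Option.some_ne_none k).symm⟩
  have hfacet : IsFacet (convexHull ℝ (Set.range up)) (simplexFace up {some k}) :=
    isFacet_convexHull_range_iff.2 ⟨some k, rfl⟩
  exact isFacet_setOf_eq_zero (coord_linear_ne_zero up (some k)) (hP.onSide_coord_some k)
    (hP.simplexFace_subset_side (Finset.mem_singleton_self _)) hfacet.nonempty
    hfacet.finrank_add_one.ge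

lemma exists_eq_side_of_isFacet [Finite κ] (hP : IsBipyramid P up down) (hh : IsFacet P h) :
    ∃ k, h = bipyramidSide P up k ∨ h = bipyramidSide P down k := by
  have := up.finiteDimensional
  have hlinear : ∀ (e : AffineBasis (Option κ) ℝ E) k, (e.coord (some k)).linear ≠ 0 := fun e k =>
    have : Nontrivial (Option κ) := ⟨none, some k, (Option.some_ne_none k).symm⟩
    coord_linear_ne_zero e (some k)
  obtain ⟨_, ⟨k, rfl⟩ | ⟨k, rfl⟩, hk⟩ := hh.exists_mem_eq_setOf_eq_zero
    (A := Set.range (fun k => up.coord (some k)) ∪ Set.range fun k => down.coord (some k))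
    ((Set.finite_range _).union (Set.finite_range _))
    (by rintro _ (⟨k, rfl⟩ | ⟨k, rfl⟩); exacts [hlinear up k, hlinear down k])
    (fun x => by simp [hP.mem_iff, or_imp, forall_and]) hP.convex hP.interior_nonempty
  exacts [⟨k, Or.inl hk⟩, ⟨k, Or.inr hk⟩]

lemma side_inter_side_subset [DecidableEq κ] (hP : IsBipyramid P up down) :
    bipyramidSide P down i ∩ bipyramidSide P up k ⊆ simplexFace up {none, some i, some k} := by
  rintro x ⟨⟨hx, hi⟩, -, hk⟩
  have hnonneg := onSide_one.1 (hP.onSide_coord_some i) x hx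
  have hnonneg' := onSide_one.1 (hP.symm.onSide_coord_some k) x hx
  have hpos := hP.symm.coord_some_pos i
  have hpos' := hP.symm.coord_some_pos k
  have heq : ∀ k, down.coord (some k) x =
      up.coord (some k) x + down.coord (some k) (up none) * up.coord none x := fun k => by
    conv_lhs => rw [hP.coord_some_eq k]
    rfl
  have hnone : up.coord none x = 0 := by
    rw [heq, hk, zero_add] at hnonneg'
    refine le_antisymm ?_ (nonneg_of_mul_nonneg_right hnonneg' hpos')
    have := heq i
    rw [hi] at this
    exact nonpos_of_mul_nonpos_right (by linarith) hpos
  have hi : up.coord (some i) x = 0 := by simpa [hi, hnone] using (heq i).symm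
  refine ⟨?_, by simp [hnone, hi, hk]⟩
  rw [up.convexHull_eq_nonneg_coord]
  rintro (_ | j)
  exacts [hnone.ge, onSide_one.1 (hP.onSide_coord_some j) x hx]

lemma mem_range_of_mem_extremePoints (hP : IsBipyramid P up down) {v : E}
    (hv : v ∈ P.extremePoints ℝ) : v = up none ∨ v = down none ∨ ∃ j, v = up (some j) := by
  rw [hP.eq_convexHull] at hv
  obtain ⟨_ | j, rfl⟩ | ⟨_ | j, rfl⟩ := extremePoints_convexHull_subset hv
  exacts [Or.inl rfl, Or.inr (Or.inr ⟨j, rfl⟩), Or.inr (Or.inl rfl),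
    Or.inr (Or.inr ⟨j, (hP.base j).symm⟩)]

end IsBipyramid

end Bipyramids

section NullBipyramids

variable {P h F : Set Spacetime} {up down : AffineBasis (Option (Fin 4)) ℝ Spacetime} {ε : ℝ}
  {i k : Fin 4}

lemma IsNullHyperface.not_neg (hh : IsNullHyperface ε P h) (hP : (interior P).Nonempty)
    (hε : ε ≠ 0) : ¬ IsNullHyperface (-ε) P h := fun hneg => by
  obtain ⟨hface, f, hf, hfh, hfP⟩ := hh
  exact hf.linear_ne_zero (hfP.linear_eq_zero_of_neg hP hε
    ((hface.isNullHyperface_iff hf hfh).1 hneg))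

namespace IsBipyramid

lemma isConvexPolytope (hP : IsBipyramid P up down) : IsConvexPolytope P :=
  ⟨⟨_, (Set.finite_range up).union (Set.finite_range down), hP.eq_convexHull⟩,
    hP.interior_nonempty⟩

lemma isHyperface_side (hP : IsBipyramid P up down) (k : Fin 4) :
    IsHyperface P (bipyramidSide P up k) :=
  isHyperface_iff_isFacet.2 (hP.isFacet_side k)

lemma isNullHyperface_side (hP : IsBipyramid P up down)
    (hk : LiesInNullHyperplane (up '' {some k}ᶜ))
    (hε : ∀ f, IsNullCoordinate f → 0 < ε * f.linear (down none - up none)) :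
    IsNullHyperface ε P (bipyramidSide P up k) := by
  obtain ⟨f, hf, hfk⟩ := liesInNullHyperplane_iff.1 hk
  obtain ⟨κ, rfl⟩ : ∃ κ : ℝ, f = κ • up.coord (some k) :=
    ⟨_, affineMap_eq_smul_coord up fun j hj => hfk _ ⟨j, hj, rfl⟩⟩
  have hpos := hε _ hf
  rw [affineMap_linear_sub, hfk (up none) ⟨none, (Option.some_ne_none k).symm, rfl⟩, sub_zero,
    AffineMap.coe_smul, Pi.smul_apply, smul_eq_mul, ← mul_assoc] at hpos
  refine ⟨hP.isHyperface_side k, _, hf, fun x hx => ?_, ?_⟩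
  · rw [AffineMap.coe_smul, Pi.smul_apply, hx.2, smul_zero]
  · rw [onSide_smul, ← one_mul (ε * κ), mul_comm,
      onSide_mul_of_pos ((pos_iff_pos_of_mul_pos hpos).2 (hP.coord_some_pos k))]
    exact hP.onSide_coord_some k

lemma isFaceBetween_sides (hP : IsBipyramid P up down) (hik : i ≠ k) :
    IsFaceBetween P (bipyramidSide P up i) (bipyramidSide P up k)
      (bipyramidSide P up i ∩ bipyramidSide P up k) := by
  have hsub : simplexFace up {some i, some k} ⊆ bipyramidSide P up i ∩ bipyramidSide P up k :=
    Set.subset_inter (hP.simplexFace_subset_side (by simp)) (hP.simplexFace_subset_side (by simp))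
  have hdim : finrank ℝ (vectorSpan ℝ (simplexFace up {some i, some k})) = 2 :=
    finrank_vectorSpan_simplexFace (by rw [Finset.card_pair (by simpa using hik)]; rfl)
  have hle := (hP.isFacet_side i).finrank_vectorSpan_inter_add_two_le (hP.isFacet_side k)
    hP.interior_nonempty (hP.side_injective.ne hik)
    ⟨up none, hP.vertex_mem_side_iff.2 (Option.some_ne_none i).symm,
      hP.vertex_mem_side_iff.2 (Option.some_ne_none k).symm⟩
  rw [finrank_fin_fun ℝ] at hle
  exact ⟨hP.isHyperface_side i, hP.isHyperface_side k, hP.side_injective.ne hik, rfl,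
    le_antisymm (Nat.le_of_add_le_add_right hle)
      (hdim.symm.le.trans (Submodule.finrank_mono (vectorSpan_mono ℝ hsub)))⟩

lemma eq_of_affDim_eq_two (hP : IsBipyramid P up down)
    (hdim : affDim (bipyramidSide P down i ∩ bipyramidSide P up k) = 2) : i = k := by
  by_contra hik
  have hle : affDim _ ≤ _ :=
    Submodule.finrank_mono (vectorSpan_mono ℝ (hP.side_inter_side_subset (i := i) (k := k)))
  rw [hdim, finrank_vectorSpan_simplexFace (d := 1)] at hle
  · omega
  · rw [Finset.card_insert_of_notMem (by simp), Finset.card_pair (by simpa using hik)]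
    rfl

lemma isNullFace_sides (hP : IsBipyramid P up down)
    (hnull : ∀ k, IsNullHyperface ε P (bipyramidSide P up k)) (hik : i ≠ k) :
    IsNullFace ε ε P (bipyramidSide P up i ∩ bipyramidSide P up k) :=
  ⟨_, _, hP.isFaceBetween_sides hik, hnull i, hnull k⟩

lemma one_lt_ncard_isNullFace_and_base_mem (hP : IsBipyramid P up down)
    (hnull : ∀ k, IsNullHyperface ε P (bipyramidSide P up k)) (j : Fin 4) :
    1 < {F | IsNullFace ε ε P F ∧ up (some j) ∈ F}.ncard := by
  obtain ⟨k, l, m, hj, hkl, hkm, hlm⟩ : ∃ k l m : Fin 4,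
      (j ≠ k ∧ j ≠ l ∧ j ≠ m) ∧ k ≠ l ∧ k ≠ m ∧ l ≠ m := by
    revert j
    decide
  have hmem : ∀ {i j}, j ≠ i → up (some j) ∈ bipyramidSide P up i := fun hji =>
    hP.vertex_mem_side_iff.2 fun e => hji (Option.some_injective _ e)
  rw [Set.one_lt_ncard_iff
    (hP.isConvexPolytope.finite_twoFaces.subset fun F hF => hF.1.isTwoFace)]
  refine ⟨_, _, ⟨hP.isNullFace_sides hnull hkl, hmem hj.1, hmem hj.2.1⟩,
    ⟨hP.isNullFace_sides hnull hkm, hmem hj.1, hmem hj.2.2⟩, fun e => ?_⟩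
  have hm : up (some m) ∈ bipyramidSide P up k ∩ bipyramidSide P up l :=
    ⟨hmem hkm.symm, hmem hlm.symm⟩
  rw [e] at hm
  exact hP.vertex_mem_side_iff.1 hm.2 rfl

lemma ncard_isNullFace_and_apex_mem_pos (hP : IsBipyramid P up down)
    (hnull : ∀ k, IsNullHyperface ε P (bipyramidSide P up k)) :
    0 < {F | IsNullFace ε ε P F ∧ up none ∈ F}.ncard :=
  (Set.ncard_pos (hP.isConvexPolytope.finite_twoFaces.subset fun _ hF => hF.1.isTwoFace)).2
    ⟨_, hP.isNullFace_sides hnull zero_ne_one,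
      hP.vertex_mem_side_iff.2 (Option.some_ne_none _).symm,
      hP.vertex_mem_side_iff.2 (Option.some_ne_none _).symm⟩

end IsBipyramid

/-- The bipyramids over a tetrahedron which, like the tetrahedral diamonds, are bounded by future
hyperfaces through the apex of `up` and by past hyperfaces through the apex of `down`. -/
structure IsNullBipyramid (P : Set Spacetime)
    (up down : AffineBasis (Option (Fin 4)) ℝ Spacetime) : Prop
    extends IsBipyramid P up down where
  isNullHyperface_up : ∀ k, IsNullHyperface (-1) P (bipyramidSide P up k)
  isNullHyperface_down : ∀ k, IsNullHyperface 1 P (bipyramidSide P down k)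

namespace IsNullBipyramid

lemma isNullFaced (hP : IsNullBipyramid P up down) : IsNullFaced P := fun h hh => by
  obtain ⟨k, rfl | rfl⟩ := hP.exists_eq_side_of_isFacet (isHyperface_iff_isFacet.1 hh)
  · obtain ⟨-, f, hf, hfh, -⟩ := hP.isNullHyperface_up k
    exact liesInNullHyperplane_iff.2 ⟨f, hf, hfh⟩
  · obtain ⟨-, f, hf, hfh, -⟩ := hP.isNullHyperface_down k
    exact liesInNullHyperplane_iff.2 ⟨f, hf, hfh⟩

lemma exists_eq_of_isNullFace (hP : IsNullBipyramid P up down) (hF : IsNullFace 1 (-1) P F) :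
    ∃ k, F = bipyramidSide P down k ∩ bipyramidSide P up k := by
  obtain ⟨_, _, ⟨hh, hk, -, rfl, hdim⟩, hpast, hfuture⟩ := hF
  have hint := hP.interior_nonempty
  obtain ⟨i, rfl | rfl⟩ := hP.exists_eq_side_of_isFacet (isHyperface_iff_isFacet.1 hh)
  · exact (hpast.not_neg hint one_ne_zero (hP.isNullHyperface_up i)).elim
  obtain ⟨k, rfl | rfl⟩ := hP.exists_eq_side_of_isFacet (isHyperface_iff_isFacet.1 hk)
  · exact ⟨i, by rw [hP.eq_of_affDim_eq_two hdim]⟩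
  · exact ((hP.isNullHyperface_down k).not_neg hint one_ne_zero hfuture).elim

lemma ncard_isNullFace_and_base_mem_le (hP : IsNullBipyramid P up down) (j : Fin 4) :
    {F | IsNullFace 1 (-1) P F ∧ up (some j) ∈ F}.ncard ≤ 3 := by
  have hsub : {F | IsNullFace 1 (-1) P F ∧ up (some j) ∈ F} ⊆
      (fun k => bipyramidSide P down k ∩ bipyramidSide P up k) '' ↑(Finset.univ.erase j) := by
    rintro F ⟨hF, hj⟩
    obtain ⟨k, rfl⟩ := hP.exists_eq_of_isNullFace hF
    have hjk : j ≠ k := fun e => hP.vertex_mem_side_iff.1 hj.2 (congrArg some e)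
    exact ⟨k, by simpa using hjk.symm, rfl⟩
  refine (Set.ncard_le_ncard hsub (Set.toFinite _)).trans
    ((Set.ncard_image_le (Set.toFinite _)).trans ?_)
  rw [Set.ncard_coe_finset, Finset.card_erase_of_mem (Finset.mem_univ j), Finset.card_fin]

lemma vertexExcess_base_neg (hP : IsNullBipyramid P up down) (j : Fin 4) :
    vertexExcess P (up (some j)) < 0 := by
  have hle := hP.ncard_isNullFace_and_base_mem_le j
  have hup := hP.one_lt_ncard_isNullFace_and_base_mem hP.isNullHyperface_up j
  have hdown := hP.symm.one_lt_ncard_isNullFace_and_base_mem hP.isNullHyperface_down j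
  rw [← hP.base] at hdown
  rw [vertexExcess]
  omega

lemma vertexExcess_up_none_neg (hP : IsNullBipyramid P up down) :
    vertexExcess P (up none) < 0 := by
  have hempty : {F | IsNullFace 1 (-1) P F ∧ up none ∈ F} = ∅ := by
    refine Set.eq_empty_of_forall_notMem ?_
    rintro F ⟨hF, hv⟩
    obtain ⟨k, rfl⟩ := hP.exists_eq_of_isNullFace hF
    exact hP.apex_notMem_side hv.1
  have hpos := hP.ncard_isNullFace_and_apex_mem_pos hP.isNullHyperface_up
  rw [vertexExcess, hempty, Set.ncard_empty]
  omega

lemma vertexExcess_down_none_neg (hP : IsNullBipyramid P up down) :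
    vertexExcess P (down none) < 0 := by
  have hempty : {F | IsNullFace 1 (-1) P F ∧ down none ∈ F} = ∅ := by
    refine Set.eq_empty_of_forall_notMem ?_
    rintro F ⟨hF, hv⟩
    obtain ⟨k, rfl⟩ := hP.exists_eq_of_isNullFace hF
    exact hP.symm.apex_notMem_side hv.2
  have hpos := hP.symm.ncard_isNullFace_and_apex_mem_pos hP.isNullHyperface_down
  rw [vertexExcess, hempty, Set.ncard_empty]
  omega

lemma vertexExcess_neg (hP : IsNullBipyramid P up down) {v : Spacetime}
    (hv : v ∈ P.extremePoints ℝ) : vertexExcess P v < 0 := by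
  obtain rfl | rfl | ⟨j, rfl⟩ := hP.mem_range_of_mem_extremePoints hv
  exacts [hP.vertexExcess_up_none_neg, hP.vertexExcess_down_none_neg, hP.vertexExcess_base_neg j]

end IsNullBipyramid

end NullBipyramids

section BipyramidConstruction

variable {κ E : Type*} [Fintype κ] [NormedAddCommGroup E] [NormedSpace ℝ E] {b : κ → E}
  {w : κ → ℝ} {f : E →ᵃ[ℝ] ℝ} {q u : E}

lemma affineMap_apply_sum (hw : ∑ j, w j = 1) : f (∑ j, w j • b j) = ∑ j, w j * f (b j) := by
  have h := Finset.univ.map_affineCombination b w hw f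
  rwa [Finset.affineCombination_eq_linear_combination _ _ _ hw,
    Finset.affineCombination_eq_linear_combination _ _ _ hw] at h

lemma exists_affineBasis_option [FiniteDimensional ℝ E] (hb : AffineIndependent ℝ b)
    (hcard : Fintype.card κ = finrank ℝ E) (hf : ∀ k, f (b k) = 0) (hq : f q ≠ 0) :
    ∃ e : AffineBasis (Option κ) ℝ E, e none = q ∧ ∀ k, e (some k) = b k := by
  let v : Option κ → E := fun j => j.elim q b
  have hv : AffineIndependent ℝ v := by
    refine AffineIndependent.affineIndependent_of_notMem_span (i := none) ?_ fun hmem => hq ?_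
    · let index : {j : Option κ // j ≠ none} ↪ κ :=
        ⟨fun j => j.1.get (Option.isSome_iff_ne_none.2 j.2), fun _ _ h =>
          Subtype.ext (Option.get_inj.1 h)⟩
      have hindex : (fun j : {j // j ≠ none} => v j) = b ∘ index := by
        funext ⟨j, hj⟩
        obtain ⟨k, rfl⟩ := Option.ne_none_iff_exists'.1 hj
        rfl
      exact hindex ▸ hb.comp_embedding index
    · have hzero : Set.EqOn f (AffineMap.const ℝ E 0) (v '' {j | j ≠ none}) := by
        rintro _ ⟨_ | j, hj, rfl⟩
        exacts [(hj rfl).elim, hf j]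
      exact AffineMap.eqOn_affineSpan hzero hmem
  exact ⟨⟨v, hv, hv.affineSpan_eq_top_iff_card_eq_finrank_add_one.2
    (by rw [Fintype.card_option, hcard])⟩, rfl, fun _ => rfl⟩

lemma coord_opposite_apex {e : AffineBasis (Option κ) ℝ E} (hw : ∑ j, w j = 1)
    (he : e none = ∑ j, w j • e (some j) + u) (k : κ) :
    e.coord (some k) (∑ j, w j • e (some j) - u) = 2 * w k := by
  classical
  have hcenter : e.coord (some k) (∑ j, w j • e (some j)) = w k := by
    rw [affineMap_apply_sum hw, Finset.sum_eq_single k, e.coord_apply_eq, mul_one]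
    · exact fun j _ hj => by rw [e.coord_apply_ne (by simpa using hj.symm), mul_zero]
    · simp
  have hapex := e.coord_apply_ne (Option.some_ne_none k)
  rw [he, affineMap_apply_add, hcenter] at hapex
  rw [sub_eq_add_neg, affineMap_apply_add, map_neg, hcenter]
  linarith

lemma exists_isBipyramid [FiniteDimensional ℝ E] (hb : AffineIndependent ℝ b)
    (hcard : Fintype.card κ = finrank ℝ E) (hf : ∀ k, f (b k) = 0) (hu : f.linear u ≠ 0)
    (hw : ∀ j, 0 < w j) (hsum : ∑ j, w j = 1) {c : E} (hc : c = ∑ j, w j • b j) :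
    ∃ up down : AffineBasis (Option κ) ℝ E,
      (up none = c + u ∧ down none = c - u ∧ ∀ k, up (some k) = b k) ∧
      IsBipyramid (convexHull ℝ (Set.range b ∪ {c - u, c + u})) up down := by
  have hfc : f c = 0 := by
    rw [hc, affineMap_apply_sum hsum]
    simp only [hf, mul_zero, Finset.sum_const_zero]
  have hfup : f (c + u) = f.linear u := by rw [affineMap_apply_add, hfc, zero_add]
  have hfdown : f (c - u) = -f.linear u := by
    rw [sub_eq_add_neg, affineMap_apply_add, hfc, zero_add, map_neg]
  obtain ⟨up, hup, hupb⟩ := exists_affineBasis_option hb hcard hf (hfup ▸ hu)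
  obtain ⟨down, hdown, hdownb⟩ := exists_affineBasis_option hb hcard hf (hfdown ▸ neg_ne_zero.2 hu)
  obtain rfl : b = fun k => up (some k) := funext fun k => (hupb k).symm
  refine ⟨up, down, ⟨hup, hdown, hupb⟩, fun k => (hdownb k).symm, ?_, fun k => ?_, ?_⟩
  · have hcoord : f = f (up none) • up.coord none := affineMap_eq_smul_coord up fun j hj => by
      obtain ⟨k, rfl⟩ := Option.ne_none_iff_exists'.1 hj
      exact hf k
    have hneg := congrArg (fun g : E →ᵃ[ℝ] ℝ => g (c - u)) hcoord
    simp only [AffineMap.coe_smul, Pi.smul_apply, smul_eq_mul, hup, hfup, hfdown] at hneg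
    rw [hdown, mul_left_cancel₀ hu (hneg.symm.trans (mul_neg_one _).symm)]
    exact neg_one_lt_zero
  · rw [hdown, hc, coord_opposite_apex hsum (hc ▸ hup)]
    exact mul_pos two_pos (hw k)
  · congr 1
    have hrange : ∀ e : AffineBasis (Option κ) ℝ E,
        Set.range e = insert (e none) (Set.range fun k => e (some k)) := fun e => by
      ext x
      simp [Option.exists, eq_comm]
    rw [hrange up, hrange down, funext hdownb, hup, hdown]
    ext x
    simp only [Set.mem_union, Set.mem_insert_iff, Set.mem_singleton_iff]
    tauto

end BipyramidConstruction

section Diamonds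

theorem IsTetrahedralDiamond.exists_isNullBipyramid {P : Set Spacetime}
    (hP : IsTetrahedralDiamond P) : ∃ up down, IsNullBipyramid P up down := by
  obtain ⟨b, w, c, u, hb, hu, horth, hw, hsum, hc, hnullDown, hnullUp, rfl⟩ := hP
  let f : Spacetime →ᵃ[ℝ] ℝ :=
    (minkowskiForm u).toAffineMap - AffineMap.const ℝ Spacetime (minkowski u (b 0))
  have hf : ∀ k, f (b k) = 0 := fun k => by
    have horth := horth k 0
    rwa [← minkowskiForm_apply, map_sub] at horth
  have hfu : f.linear u = minkowski u u := by simp [f, minkowskiForm_apply]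
  obtain ⟨up, down, ⟨hup, hdown, hbase⟩, hbip⟩ := exists_isBipyramid hb
    (finrank_fin_fun ℝ).symm hf (hfu ▸ hu.1.ne) hw hsum hc
  have hside : ∀ (e : AffineBasis (Option (Fin 4)) ℝ Spacetime), (∀ k, e (some k) = b k) →
      ∀ k, e '' {some k}ᶜ ⊆ insert (e none) (b '' {k}ᶜ) := by
    rintro e he k _ ⟨_ | j, hj, rfl⟩
    · exact Set.mem_insert _ _
    · exact Set.mem_insert_of_mem _ ⟨j, fun h => hj (congrArg some h), (he j).symm⟩
  refine ⟨up, down, hbip, fun k => ?_, fun k => ?_⟩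
  · obtain ⟨n, d, hn, hd⟩ := hnullUp k
    refine hbip.isNullHyperface_side
      ⟨n, d, hn, fun x hx => hd x (hup ▸ hside up hbase k hx)⟩ fun g hg => ?_
    have hpos := hg.linear_pos hu
    rw [hup, hdown, show c - u - (c + u) = -u + -u by abel, map_add, map_neg]
    linarith
  · obtain ⟨n, d, hn, hd⟩ := hnullDown k
    refine hbip.symm.isNullHyperface_side ⟨n, d, hn, fun x hx =>
      hd x (hdown ▸ hside down (fun k => (hbip.base k).symm.trans (hbase k)) k hx)⟩ fun g hg => ?_
    have hpos := hg.linear_pos hu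
    rw [hup, hdown, show c + u - (c - u) = u + u by abel, map_add]
    linarith

theorem not_exists_isTessellation_of_isTetrahedralDiamond :
    ¬ ∃ 𝒯, IsTessellation 𝒯 ∧ ∀ P ∈ 𝒯, IsTetrahedralDiamond P := by
  rintro ⟨𝒯, h𝒯, hdiamond⟩
  have hnull : ∀ P ∈ 𝒯, IsNullFaced P := fun P hP =>
    let ⟨_, _, h⟩ := (hdiamond P hP).exists_isNullBipyramid
    h.isNullFaced
  obtain ⟨P, hP⟩ := h𝒯.exists_mem
  have hpolytope := h𝒯.polytope P hP
  obtain ⟨v, hv⟩ := hpolytope.isCompact.extremePoints_nonempty (hpolytope.2.mono interior_subset)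
  have hneg : ∀ Q ∈ h𝒯.tilesAt v, vertexExcess Q v < 0 := fun Q hQ => by
    obtain ⟨hQ, hv⟩ := h𝒯.mem_tilesAt.1 hQ
    obtain ⟨_, _, h⟩ := (hdiamond Q hQ).exists_isNullBipyramid
    exact h.vertexExcess_neg hv
  exact (Finset.sum_neg hneg ⟨P, h𝒯.mem_tilesAt.2 ⟨hP, hv⟩⟩).ne
    (h𝒯.sum_vertexExcess_eq_zero hnull v)

end Diamonds

theorem mainTheorem3 :
    -- the causal structure of null-faced 4-simplices
    (∀ P, IsNullFacedSimplex P →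
      {h | IsHyperface P h}.ncard = 5 ∧
      (∀ h, IsHyperface P h → Xor (IsPastHyperface P h) (IsFutureHyperface P h)) ∧
      {F | IsTwoFace P F}.ncard = 10 ∧
      {F | IsPastFutureFace P F}.ncard = 6 ∧
      (({h | IsPastHyperface P h}.ncard = 2 ∧ {h | IsFutureHyperface P h}.ncard = 3 ∧
          {F | IsPastPastFace P F}.ncard = 1 ∧ {F | IsFutureFutureFace P F}.ncard = 3) ∨
        ({h | IsPastHyperface P h}.ncard = 3 ∧ {h | IsFutureHyperface P h}.ncard = 2 ∧
          {F | IsPastPastFace P F}.ncard = 3 ∧ {F | IsFutureFutureFace P F}.ncard = 1))) ∧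
    -- the balance of dihedral incidences at each 2d face of a tessellation with null hyperfaces
    (∀ 𝒯, IsTessellation 𝒯 → (∀ P ∈ 𝒯, IsNullFaced P) →
      ∀ P ∈ 𝒯, ∀ F, IsTwoFace P F →
        {Q | Q ∈ 𝒯 ∧ IsTwoFace Q F}.Finite ∧
        {Q | Q ∈ 𝒯 ∧ IsPastFutureFace Q F}.ncard =
          {Q | Q ∈ 𝒯 ∧ IsPastPastFace Q F}.ncard +
          {Q | Q ∈ 𝒯 ∧ IsFutureFutureFace Q F}.ncard) ∧
    -- no tessellation by null-faced 4-simplices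
    (¬ ∃ 𝒯, IsTessellation 𝒯 ∧ ∀ P ∈ 𝒯, IsNullFacedSimplex P) ∧
    -- no tessellation by tetrahedral diamonds
    (¬ ∃ 𝒯, IsTessellation 𝒯 ∧ ∀ P ∈ 𝒯, IsTetrahedralDiamond P) := by
  refine ⟨fun _ hP => hP.causalStructure, fun 𝒯 h𝒯 hnull P hP F hPF => ?_,
    not_exists_isTessellation_of_isNullFacedSimplex,
    not_exists_isTessellation_of_isTetrahedralDiamond⟩
  simp only [isPastPastFace_iff, isPastFutureFace_iff, isFutureFutureFace_iff]
  exact h𝒯.finite_and_ncard_isNullFace_eq hnull hP hPF
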